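/- **Setting.** Consider an $n$-player normal-form game ($n\ge 1$) in which player $k$ has $m_k$ actions and payoffs $u_k:\prod_j[m_j]\to[0,1]$, extended multilinearly to mixed profiles $x=(x_1,\dots,x_n)\in\prod_k\Delta^{m_k-1}$. The exploitability of $x$ is $\epsilon(x)=\max_k\big(\max_{z}u_k(z,x_{-k})-u_k(x)\big)$. Let $\nabla^k_x\in\mathbb R^{m_k}$ be the vector of expected payoffs of player $k$'s actions against $x_{-k}$, let $\Pi v=v-\frac1{m_k}(\mathbf 1^\top v)\mathbf 1$, and for $\tau,\eta_k>0$ let $$\mathcal L^\tau(x)=\sum_k\eta_k\big\|\Pi(\nabla^k_x-\tau(\ln x_k+\mathbf 1))\big\|_2^2 .$$ A QRE($\tau$) is a profile with $x_k=\mathrm{softmax}(\nabla^k_x/\tau)$ for all $k$. A sample of the loss at $x$ is $\hat{\mathcal L}^\tau(x)=\sum_k\eta_k\langle\Pi(g_k-\tau(\ln x_k+\mathbf 1)),\Pi(g'_k-\tau(\ln x_k+\mathbf 1))\rangle$, where $g,g'$ are two independent copies of a (discrete) random estimate of $(\nabla^k_x)_k$ that is unbiased and has entries in $[0,1]$ (for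 example $g_{k,l}=u_k(l,a_{-k})$ with $a\sim x$). Let $p\in(0,1)$, $\tau=1/\ln(1/p)$, $m^*=\max_k m_k$, $M=\sum_k m_k=n\bar m$, $d=\sum_k(m_k-1)$, $\rho=\frac{\ln m^*}{\ln(1/p)}+2$, $\hat L=\rho\big(\frac{m^{*2}}{p\ln(1/p)}+M\big)$ and $\eta_k=2/\hat L$ for all $k$. Let $s:[0,1]^d\to\prod_k\Delta^{m_k-1}$ be a map and $F=\mathcal L^\tau\circ s$. Assume: (1) every $s(z)$ has all its probabilities at least $p/m^*$, and some $s(z)$ is a QRE($\tau$); (2) $|F(z)-F(z')|\le\|z-z'\|_\infty$ on $[0,1]^d$; (3) the set $\mathcal X^*$ of global minimizers of $F$ is finite, and $F$ is locally strongly convex about it in the following sense: with $\sigma,r>0$, whenever $F(z)\le\min F+\sigma r^2$ there is $z^*\in\mathcal X^*$ with $F(z)\ge F(z^*)+\sigma\|z-z^*\|_\infty^2$ (so $\|z-z^*\|_\infty\le r$); (4) $\sigma$ and $r$ are small enough that $|\mathcal X^*|^{-1}(2r^2\sqrt\sigma)^{-d}\ge1$. Put $d_z=\frac12M$ and $C_z=\big(\frac{4}{r^2\sigma}\big)^{M}$.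 **D-BLiN.** Pulling the arm $z\in[0,1]^d$ gives an independent reward distributed as $-\hat{\mathcal L}^\tau(s(z))$. With horizon $T$ and parameters $c_1,c_2>0$, batch $i=1,2,\dots$ has edge length $r_i=2^{1-i}$. The first batch has the single active cube $[0,1]^d$. In batch $i$ one pulls $\lceil c_2\ln T/r_i^2\rceil$ arms in each active cube. Then every cube whose average reward is at least $2(1+\sqrt{c_1/c_2})\,r_i$ below the largest average is eliminated, and every other cube is divided into $2^d$ cubes of half the edge length, which are the active cubes of batch $i+1$. As soon as a batch would bring the number of pulls to $T$ or more, the remaining pulls up to $T$ are instead spent arbitrarily in the active cubes. Which arms of a cube are pulled is an arbitrary function of the observations of earlier batches. **Theorem (BLiN PAC rate).** (a) $|\mathcal L^\tau(x)-\mathcal L^\tau(y)|\le\|x-y\|_1$ for all mixed profiles $x,y$ whose probabilities are all at least $p/m^*$. (b) The possible values of the rewards, over all arms, lie in one interval of length $\frac{M}{\hat L}\rho^2$. (c) Let $0<c\le\frac{M}{\hat L}\rho^2$ be such that the possible values of the rewards, over all arms, lie in one interval of length $c$. Run D-BLiN with any integer $T\ge2$, $c_1=2c^2$ and $c_2=2\big(\frac{c}{4C_z}\big)^{2/3}$,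 and let $z_t$ be the arm pulled at a time $t$ that is uniform on $\{1,\dots,T\}$ and independent of the run. Then for every $w>0$, with probability at least $(1-w^{-1})(1-2T^{-2})$, $$\epsilon(s(z_t))\le w\Big[\frac{1}{\ln(1/p)}\ln\Big(\prod_k m_k\Big)+2\big(1+(4c^2C_z)^{1/3}\big)\sqrt{2n\hat L}\,\Big(\frac{\ln T}{T}\Big)^{\frac1{2(d_z+2)}}\Big].$$ -/

import Mathlib

open scoped ENNReal

noncomputable section

namespace NashBandit

/-! ### Normal-form games -/

/-- Joint actions of an `n`-player game in which player `k` has `m k` actions. -/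
abbrev Profile {n : ℕ} (m : Fin n → ℕ) : Type := ∀ k, Fin (m k)

/-- Joint mixed strategies: points of the product of the probability simplices. -/
abbrev MixedProfile {n : ℕ} (m : Fin n → ℕ) : Type := ∀ k, ↥(stdSimplex ℝ (Fin (m k)))

variable {n : ℕ} {m : Fin n → ℕ}

/-- The probability that the players, mixing independently, play the joint action `a`. -/
def weight (x : MixedProfile m) (a : Profile m) : ℝ := ∏ j, (x j).1 (a j)

theorem weight_nonneg (x : MixedProfile m) (a : Profile m) : 0 ≤ weight x a :=
  Finset.prod_nonneg fun j _ => (x j).2.1 (a j)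

/-- Multilinear extension of player `k`'s payoff. -/
def utility (u : Fin n → Profile m → ℝ) (k : Fin n) (x : MixedProfile m) : ℝ :=
  ∑ a, weight x a * u k a

/-- `ε_k(x) = max_z u_k(z, x_{-k}) - u_k(x)`. -/
def playerExploitability (u : Fin n → Profile m → ℝ) (k : Fin n) (x : MixedProfile m) : ℝ :=
  (⨆ z : ↥(stdSimplex ℝ (Fin (m k))), utility u k (Function.update x k z)) - utility u k x

/-- Exploitability `ε(x) = max_k ε_k(x)`. -/
def exploitability (u : Fin n → Profile m → ℝ) (x : MixedProfile m) : ℝ :=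
  ⨆ k, playerExploitability u k x

/-- Entry `l` of player `k`'s utility gradient: the expected payoff of action `l` against the
mixed strategies of the other players. (The component `a k` is overwritten, so the summation
over it contributes the factor `1`.) -/
def gradient (u : Fin n → Profile m → ℝ) (x : MixedProfile m) (k : Fin n) (l : Fin (m k)) : ℝ :=
  ∑ a, weight x a * u k (Function.update a k l)

/-- Logit quantal response equilibrium at temperature `τ`: `x_k = softmax (∇_k / τ)`. -/
def IsQRE (u : Fin n → Profile m → ℝ) (τ : ℝ) (x : MixedProfile m) : Prop :=
  ∀ k l, (x k).1 l = Real.exp (gradient u x k l / τ) / ∑ j, Real.exp (gradient u x k j / τ)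

/-! ### The loss and its unbiased estimates -/

/-- Projection `(I - 11ᵀ/d) v` onto the tangent space of the simplex. -/
def tangentProj {d : ℕ} (v : Fin d → ℝ) : Fin d → ℝ := fun l => v l - (∑ j, v j) / d

/-- Adds the gradient `-τ (ln x_k + 1)` of the entropy bonus `τ S(x_k)` to `g`. -/
def addEntropy (τ : ℝ) (x : MixedProfile m) (g : ∀ k, Fin (m k) → ℝ) (k : Fin n) :
    Fin (m k) → ℝ :=
  fun l => g k l - τ * (Real.log ((x k).1 l) + 1)

/-- `L^τ(x) = ∑_k η_k ‖Π(∇_k^τ)‖²`. -/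
def loss (u : Fin n → Profile m → ℝ) (η : Fin n → ℝ) (τ : ℝ) (x : MixedProfile m) : ℝ :=
  ∑ k, η k * ∑ l, tangentProj (addEntropy τ x (gradient u x) k) l ^ 2

/-- A random estimate of all the players' gradients, unbiased and with entries in `[0, 1]`. -/
structure GradientEstimator (u : Fin n → Profile m → ℝ) where
  law : MixedProfile m → PMF (∀ k, Fin (m k) → ℝ)
  mem_unit : ∀ x, ∀ g ∈ (law x).support, ∀ k l, g k l ∈ Set.Icc (0 : ℝ) 1
  unbiased : ∀ x k l, ∑' g, (law x g).toReal * g k l = gradient u x k l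

/-- The law of the one-shot loss estimate `∑_k η_k ⟨Π(∇̂_k^{τ(1)}), Π(∇̂_k^{τ(2)})⟩` built from two
independent gradient estimates. -/
def lossSample {u : Fin n → Profile m → ℝ} (est : GradientEstimator u) (η : Fin n → ℝ) (τ : ℝ)
    (x : MixedProfile m) : PMF ℝ :=
  (est.law x).bind fun g => (est.law x).map fun g' =>
    ∑ k, η k * ∑ l, tangentProj (addEntropy τ x g k) l * tangentProj (addEntropy τ x g' k) l

/-- The product distribution of joint actions. -/
def profileLaw (x : MixedProfile m) : PMF (Profile m) :=
  PMF.ofFintype (fun a => ENNReal.ofReal (weight x a)) (by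
    rw [← ENNReal.ofReal_sum_of_nonneg fun a _ => weight_nonneg x a]
    have h : ∑ a, weight x a = 1 := by
      unfold weight
      rw [← Fintype.prod_sum (fun j l => (x j).1 l)]
      exact Finset.prod_eq_one fun j _ => (x j).2.2
    rw [h, ENNReal.ofReal_one])

/-- Sampling estimator: draw `a ∼ x` and return `u_k(l, a_{-k})` for all `k` and `l`. -/
def sampleOthers (u : Fin n → Profile m → ℝ) (hu : ∀ k a, u k a ∈ Set.Icc (0 : ℝ) 1) :
    GradientEstimator u where
  law x := (profileLaw x).map fun a k l => u k (Function.update a k l)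
  mem_unit := by
    intro x g hg k l
    rw [PMF.mem_support_map_iff] at hg
    obtain ⟨a, -, rfl⟩ := hg
    exact hu k _
  unbiased := by
    classical
    intro x k l
    have key : ∀ g : (∀ k, Fin (m k) → ℝ),
        ((profileLaw x).map (fun a k l => u k (Function.update a k l)) g).toReal * g k l
          = ∑ a, if g = (fun k l => u k (Function.update a k l)) then
              weight x a * u k (Function.update a k l) else 0 := by
      intro g
      rw [PMF.map_apply, tsum_fintype, ENNReal.toReal_sum, Finset.sum_mul]
      · refine Finset.sum_congr rfl fun a _ => ?_
        by_cases h : g = (fun k l => u k (Function.update a k l))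
        · rw [if_pos h, if_pos h, h]
          simp only [profileLaw, PMF.ofFintype_apply]
          rw [ENNReal.toReal_ofReal (weight_nonneg x a)]
        · rw [if_neg h, if_neg h]; simp
      · intro a _
        split_ifs
        · exact PMF.apply_ne_top _ _
        · simp
    simp_rw [key]
    rw [Summable.tsum_finsetSum]
    · simp only [tsum_ite_eq, gradient]
    · intro a _
      exact (hasSum_ite_eq _ _).summable

/-! ### Doubling BLiN on the unit cube -/

/-- Arms: points of `[0, 1]^d`; its distance is the one of the sup norm. -/
abbrev Arm (d : ℕ) : Type := ↥(Set.Icc (0 : Fin d → ℝ) 1)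

/-- The dyadic subcube of edge length `2^{-j}` with lower corner `2^{-j} C`. -/
def cube {d : ℕ} (j : ℕ) (C : Fin d → ℕ) : Set (Arm d) :=
  {z | ∀ i, (C i : ℝ) / 2 ^ j ≤ z.1 i ∧ z.1 i ≤ ((C i : ℝ) + 1) / 2 ^ j}

/-- The indices, one level deeper, of the `2^d` subcubes of half the edge length. -/
def children {d : ℕ} (C : Fin d → ℕ) : List (Fin d → ℕ) :=
  (Fintype.piFinset fun i => ({2 * C i, 2 * C i + 1} : Finset ℕ)).toList

/-- The choices that the algorithm leaves open: which arms of a cube are played in a batch, and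
which arms of the active cubes are played in the final clean-up. They may depend on all the
observations of the earlier batches, as well as on the level `j` (edge length `2^{-j}`). -/
structure SelectionRule (d : ℕ) where
  pick : List (Arm d × ℝ) → ℕ → (Fin d → ℕ) → ℕ → Arm d
  pick_mem : ∀ h j C i, (∀ q, C q < 2 ^ j) → pick h j C i ∈ cube j C
  fill : List (Arm d × ℝ) → ℕ → List (Fin d → ℕ) → ℕ → Arm d
  fill_mem : ∀ h j A i, A ≠ [] → (∀ C ∈ A, ∀ q, C q < 2 ^ j) → ∃ C ∈ A, fill h j A i ∈ cube j C

variable {d : ℕ}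

/-- Pull the listed arms one after the other, with independent rewards. -/
def pullAll (reward : Arm d → PMF ℝ) : List (Arm d) → PMF (List (Arm d × ℝ))
  | [] => PMF.pure []
  | z :: zs => (reward z).bind fun y => (pullAll reward zs).map fun o => (z, y) :: o

/-- Pull `N` arms in each of the listed cubes and record the observations cube by cube. -/
def playBatch (reward : Arm d → PMF ℝ) (pick : (Fin d → ℕ) → ℕ → Arm d) (N : ℕ) :
    List (Fin d → ℕ) → PMF (List ((Fin d → ℕ) × List (Arm d × ℝ)))
  | [] => PMF.pure []
  | C :: A => (pullAll reward ((List.range N).map (pick C))).bind fun o =>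
      (playBatch reward pick N A).map fun b => (C, o) :: b

/-- Average observed reward. -/
def meanReward (o : List (Arm d × ℝ)) : ℝ := (o.map Prod.snd).sum / o.length

open Classical in
/-- Eliminate every cube whose average reward is at least `thr` below the largest one. -/
def survivors (thr : ℝ) (b : List ((Fin d → ℕ) × List (Arm d × ℝ))) : List (Fin d → ℕ) :=
  (b.filter fun e => decide (∀ e' ∈ b, meanReward e'.2 - meanReward e.2 < thr)).map Prod.fst

/-- The batches from level `j` on, with active cubes `A` and past observations `h`. If the next
batch would use up the horizon `T`, the remaining pulls are spent in the active cubes. Otherwise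
the batch is played, cubes are eliminated, and the others are divided. `fuel` bounds the number
of batches. -/
def batches (reward : Arm d → PMF ℝ) (sel : SelectionRule d) (T : ℕ) (pulls : ℕ → ℕ)
    (thr : ℕ → ℝ) :
    (fuel : ℕ) → (j : ℕ) → (A : List (Fin d → ℕ)) → (h : List (Arm d × ℝ)) →
      PMF (List (Arm d × ℝ))
  | 0, _, _, h => PMF.pure h
  | fuel + 1, j, A, h =>
    if T ≤ h.length + A.length * pulls j then
      (pullAll reward ((List.range (T - h.length)).map (sel.fill h j A))).map fun o => h ++ o
    else
      (playBatch reward (sel.pick h j) (pulls j) A).bind fun b =>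
        batches reward sel T pulls thr fuel (j + 1)
          ((survivors (thr j) b).flatMap children) (h ++ b.flatMap Prod.snd)

/-- D-BLiN with horizon `T` and parameters `c₁, c₂`: batch `j + 1` has edge length `r = 2^{-j}`,
each active cube is pulled `⌈c₂ ln T / r²⌉` times, and the elimination threshold is
`2 (1 + √(c₁ / c₂)) r`. The first active cube is `[0, 1]^d`. Every batch has at least one pull, so
`T + 1` batches are never exceeded. The outcome is the list of all pulled arms and rewards. -/
def dblin (reward : Arm d → PMF ℝ) (sel : SelectionRule d) (T : ℕ) (c₁ c₂ : ℝ) :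
    PMF (List (Arm d × ℝ)) :=
  batches reward sel T (fun j => ⌈c₂ * Real.log T / ((1 / 2 : ℝ) ^ j) ^ 2⌉₊)
    (fun j => 2 * (1 + √(c₁ / c₂)) * (1 / 2 : ℝ) ^ j) (T + 1) 0 [fun _ => 0] []

/-- The arm that was pulled at a uniformly random time `t ∈ [T]` (`none` if there was no such
pull). -/
def randomPulledArm (T : ℕ) [NeZero T] (run : PMF (List (Arm d × ℝ))) : PMF (Option (Arm d)) :=
  run.bind fun h => (PMF.uniformOfFintype (Fin T)).map fun t => h[(t : ℕ)]?.map Prod.fst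

/-! ### The bandit problem -/

/-- The global minimizers of `F` on the cube. -/
def globalOptima (F : Arm d → ℝ) : Set (Arm d) := {z | ∀ z', F z ≤ F z'}

/-- Local strong convexity with respect to the sup norm about the global optima, in the form of
the lower bound `F(z) ≥ F(z*) + σ ‖z - z*‖²` valid for every `z` whose value is within `σ r²` of
the optimum (so that `‖z - z*‖ ≤ r`), for an optimum `z*` next to `z`. -/
def LocalQuadraticGrowth (F : Arm d → ℝ) (σ r : ℝ) : Prop :=
  ∀ z, (∃ z₀ ∈ globalOptima F, F z ≤ F z₀ + σ * r ^ 2) →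
    ∃ z₁ ∈ globalOptima F, F z₁ + σ * dist z z₁ ^ 2 ≤ F z

/-- All possible rewards, over all arms, lie in one interval of length `c`. -/
def RangeLE (reward : Arm d → PMF ℝ) (c : ℝ) : Prop :=
  ∃ a, ∀ z, ∀ y ∈ (reward z).support, y ∈ Set.Icc a (a + c)

/-- `m* = max_k m_k`. -/
def maxActions (m : Fin n → ℕ) : ℕ := Finset.univ.sup m

/-- `n m̄ = ∑_k m_k`. -/
def totalActions (m : Fin n → ℕ) : ℕ := ∑ k, m k

/-- Dimension `n (m̄ - 1) = ∑_k (m_k - 1)` of the cube. -/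
def cubeDim (m : Fin n → ℕ) : ℕ := ∑ k, (m k - 1)

/-- `ln(m*) / ln(1/p) + 2`. -/
def gradRange (m : Fin n → ℕ) (p : ℝ) : ℝ := Real.log (maxActions m) / Real.log (1 / p) + 2

/-- `L̂`. -/
def Lhat (m : Fin n → ℕ) (p : ℝ) : ℝ :=
  gradRange m p * ((maxActions m : ℝ) ^ 2 / (p * Real.log (1 / p)) + totalActions m)

/-- `(n m̄ / L̂) (ln(m*) / ln(1/p) + 2)²`. -/
def rangeBound (m : Fin n → ℕ) (p : ℝ) : ℝ := totalActions m / Lhat m p * gradRange m p ^ 2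

/-- Zooming dimension `d_z = n m̄ / 2`. -/
def zoomDim (m : Fin n → ℕ) : ℝ := totalActions m / 2

/-- Zooming constant `C_z = (4 / (r² σ))^{n m̄}`. -/
def zoomConst (m : Fin n → ℕ) (σ r : ℝ) : ℝ := (4 / (r ^ 2 * σ)) ^ totalActions m

/-- The exploitability guarantee, before multiplication by `w`. -/
def pacBound (m : Fin n → ℕ) (p c σ r : ℝ) (T : ℕ) : ℝ :=
  1 / Real.log (1 / p) * Real.log ((∏ k, m k : ℕ) : ℝ)
    + 2 * (1 + (4 * c ^ 2 * zoomConst m σ r) ^ (1 / 3 : ℝ)) * √(2 * n * Lhat m p)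
      * (Real.log T / T) ^ (1 / (2 * (zoomDim m + 2)))

end NashBandit

end

open NashBandit

open NashBandit

namespace NashBandit

/-! Write ρ for `gradRange m p` and L̂ for `Lhat m p`. At interior profiles every entry of ∇ - τ(ln
x + 1) lies in an interval of length ρ. By Popoviciu and Cauchy-Schwarz, ⟨Πv, Πw⟩ is at most d/4
times the product of the two ranges; this gives (b) at once.

For (a), change one player j at a time. Since Π is an orthogonal projection, ‖Πv‖² - ‖Πw‖² = ⟨Πv +
Πw, v - w⟩. For k ≠ j, v - w is linear in the change of x_j, which costs m_k ρ/2; for k = j only the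
logarithm moves, which costs ρ m*² τ/(2p). The sum of these costs is at most L̂/2, and η = 2/L̂
turns it into Lipschitz constant 1 (`abs_loss_update_sub_le`).

For (c), the rewards have mean -F (`expect_neg_lossSample`), F ≥ 0, and F vanishes at a QRE.
Moreover ε ≤ τ ln ∏ m_k + √(L̂ F) (`exploitability_le`), so it suffices to bound the average of F
along the run. Put q = √(c₁/c₂) = (4c²C_z)^{1/3}. By Hoeffding and the Lipschitz bound, the average
reward of a cube of edge 2^{-j} predicts -F on it up to (1 + q)2^{-j}, except with probability
2T^{-4}. On the good event the cube of the optimum survives, and every active cube of level j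
satisfies F ≤ 8(1 + q)2^{-j} (`Active.next`).

Quadratic growth puts such cubes inside sup-norm balls of radius of order 2^{-j/2} about the optima.
Comparing volumes, there are at most (B √2^j)^d of them (`card_sublevel_cubes_le`), so the
near-optimality dimension is d/2. The statement uses d_z = (d + n)/2 instead; the spare factors A^n
≥ 4 and x^n ≤ 1, with A = 4/(r²σ) and x the rate (ln T/T)^{1/(d+n+4)}, absorb the numerical
constants. Cutting the levels at 2^{-I} ≈ (1 + q)x² gives average regret at most 8(1 + q)²x²
(`toOuterMeasure_regret_dblin_le`). Cauchy-Schwarz carries this average through the square root, and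
Markov's inequality for the uniform time gives the factor w. -/

/-! ### The projection onto the tangent space of the simplex. -/

theorem sum_mul_tangentProj_tangentProj {d : ℕ} (v w : Fin d → ℝ) :
    ∑ l, tangentProj v l * tangentProj w l = ∑ l, tangentProj v l * w l := by
  rcases Nat.eq_zero_or_pos d with rfl | hd
  · simp
  have hd' : (d : ℝ) ≠ 0 := by positivity
  have h0 : ∑ l, tangentProj v l = 0 := by
    simp only [tangentProj, Finset.sum_sub_distrib, Finset.sum_const, Finset.card_univ,
      Fintype.card_fin, nsmul_eq_mul]
    field_simp
    ring
  have : ∀ l, tangentProj v l * tangentProj w l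
      = tangentProj v l * w l - tangentProj v l * ((∑ j, w j) / d) := fun l => by
    simp only [tangentProj]; ring
  rw [Finset.sum_congr rfl fun l _ => this l, Finset.sum_sub_distrib, ← Finset.sum_mul, h0]
  ring

theorem tangentProj_add_const {d : ℕ} (v : Fin d → ℝ) (t : ℝ) :
    tangentProj (fun l => v l + t) = tangentProj v := by
  funext l
  have hd : (d : ℝ) ≠ 0 := by
    have : 0 < d := Nat.pos_of_ne_zero (by rintro rfl; exact l.elim0)
    positivity
  simp only [tangentProj, Finset.sum_add_distrib, Finset.sum_const, Finset.card_univ,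
      Fintype.card_fin, nsmul_eq_mul]
  field_simp
  ring

/-- Popoviciu's inequality. -/
theorem sum_sq_tangentProj_le {d : ℕ} {v : Fin d → ℝ} {a ρ : ℝ}
    (hv : ∀ l, v l ∈ Set.Icc a (a + ρ)) :
    ∑ l, tangentProj v l ^ 2 ≤ d * ρ ^ 2 / 4 := by
  -- Π ignores constants, so the entries may be centred at the midpoint, after which each is at most
  -- ρ/2 in size.
  set t := -(a + ρ / 2) with ht
  rw [← tangentProj_add_const v t]
  set w : Fin d → ℝ := fun l => v l + t with hw
  have h1 : ∑ l, tangentProj w l ^ 2 = ∑ l, tangentProj w l * w l := by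
    rw [← sum_mul_tangentProj_tangentProj]
    exact Finset.sum_congr rfl fun l _ => sq _
  have h2 : ∑ l, tangentProj w l * w l ≤ ∑ l, (tangentProj w l ^ 2 / 2 + w l ^ 2 / 2) :=
    Finset.sum_le_sum fun l _ => by nlinarith [sq_nonneg (tangentProj w l - w l)]
  have h3 : ∑ l, w l ^ 2 ≤ ∑ _l : Fin d, ρ ^ 2 / 4 := Finset.sum_le_sum fun l _ => by
    obtain ⟨h, h'⟩ := hv l
    simp only [hw, ht]
    nlinarith
  rw [Finset.sum_add_distrib, ← Finset.sum_div, ← Finset.sum_div] at h2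
  simp only [Finset.sum_const, Finset.card_univ, Fintype.card_fin, nsmul_eq_mul] at h3
  linarith

theorem abs_sum_tangentProj_mul_le {d : ℕ} {v w : Fin d → ℝ} {a b ρ ρ' : ℝ} (hρ : 0 ≤ ρ)
    (hρ' : 0 ≤ ρ') (hv : ∀ l, v l ∈ Set.Icc a (a + ρ)) (hw : ∀ l, w l ∈ Set.Icc b (b + ρ')) :
    |∑ l, tangentProj v l * tangentProj w l| ≤ d * (ρ * ρ') / 4 := by
  refine abs_le_of_sq_le_sq ?_ (by positivity)
  calc _ ≤ (∑ l, tangentProj v l ^ 2) * ∑ l, tangentProj w l ^ 2 :=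
        Finset.sum_mul_sq_le_sq_mul_sq _ _ _
    _ ≤ (d * ρ ^ 2 / 4) * (d * ρ' ^ 2 / 4) :=
        mul_le_mul (sum_sq_tangentProj_le hv) (sum_sq_tangentProj_le hw)
          (Finset.sum_nonneg fun _ _ => sq_nonneg _) (by positivity)
    _ = _ := by ring

/-- Entry l of Πv is the sum of the d - 1 differences v_l - v_j, j ≠ l, divided by d. -/
theorem abs_tangentProj_le {d : ℕ} {v : Fin d → ℝ} {a ρ : ℝ}
    (hv : ∀ l, v l ∈ Set.Icc a (a + ρ)) (l : Fin d) :
    |tangentProj v l| ≤ ρ * (1 - 1 / d) := by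
  have hd : 0 < (d : ℝ) := by
    have : 0 < d := Nat.pos_of_ne_zero (by rintro rfl; exact l.elim0)
    positivity
  have h1 : tangentProj v l = (∑ j ∈ Finset.univ.erase l, (v l - v j)) / d := by
    have : ∑ j ∈ Finset.univ.erase l, (v l - v j) = ∑ j, (v l - v j) := by
      rw [← Finset.add_sum_erase _ _ (Finset.mem_univ l)]; simp
    rw [this]
    simp only [tangentProj, Finset.sum_sub_distrib, Finset.sum_const, Finset.card_univ,
      Fintype.card_fin, nsmul_eq_mul]
    field_simp
  have h2 : |∑ j ∈ Finset.univ.erase l, (v l - v j)| ≤ (d - 1) * ρ := by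
    refine (Finset.abs_sum_le_sum_abs _ _).trans ?_
    have : ∑ j ∈ Finset.univ.erase l, |v l - v j| ≤ ∑ j ∈ Finset.univ.erase l, ρ :=
      Finset.sum_le_sum fun j _ => by
        obtain ⟨h, h'⟩ := hv l
        obtain ⟨k, k'⟩ := hv j
        rw [abs_le]; constructor <;> linarith
    refine this.trans_eq ?_
    rw [Finset.sum_const, Finset.card_erase_of_mem (Finset.mem_univ l), Finset.card_univ,
      Fintype.card_fin, nsmul_eq_mul, Nat.cast_sub (by exact_mod_cast hd)]
    simp
  rw [h1, abs_div, abs_of_pos hd, div_le_iff₀ hd]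
  refine h2.trans_eq ?_
  field_simp

/-! ### Multilinearity of weights, utilities and gradients. -/

variable {n : ℕ} {m : Fin n → ℕ}

theorem sum_weight (x : MixedProfile m) : ∑ a, weight x a = 1 := by
  unfold weight
  rw [← Fintype.prod_sum (fun j l => (x j).1 l)]
  exact Finset.prod_eq_one fun j _ => (x j).2.2

theorem weight_update (x : MixedProfile m) (j : Fin n) (z : ↥(stdSimplex ℝ (Fin (m j))))
    (a : Profile m) :
    weight (Function.update x j z) a = z.1 (a j) * ∏ q ∈ Finset.univ.erase j, (x q).1 (a q) := by
  unfold weight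
  rw [← Finset.mul_prod_erase _ _ (Finset.mem_univ j), Function.update_self]
  congr 1
  refine Finset.prod_congr rfl fun q hq => ?_
  rw [Function.update_of_ne (Finset.ne_of_mem_erase hq)]

/-- A pure strategy, as a vertex of the simplex. -/
noncomputable def vertex {d : ℕ} (i : Fin d) : ↥(stdSimplex ℝ (Fin d)) :=
  ⟨Pi.single i 1, single_mem_stdSimplex ℝ i⟩

theorem weight_update_eq_sum_vertex (x : MixedProfile m) (j : Fin n)
    (z : ↥(stdSimplex ℝ (Fin (m j)))) (a : Profile m) :
    weight (Function.update x j z) a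
      = ∑ i, z.1 i * weight (Function.update x j (vertex i)) a := by
  simp only [weight_update, vertex, Pi.single_apply]
  simp

theorem gradient_update_eq_sum_vertex (u : Fin n → Profile m → ℝ) (x : MixedProfile m)
    (j : Fin n) (z : ↥(stdSimplex ℝ (Fin (m j)))) (k : Fin n) (l : Fin (m k)) :
    gradient u (Function.update x j z) k l
      = ∑ i, z.1 i * gradient u (Function.update x j (vertex i)) k l := by
  unfold gradient
  simp_rw [weight_update_eq_sum_vertex x j z, Finset.sum_mul, Finset.mul_sum]
  rw [Finset.sum_comm]
  simp_rw [mul_assoc]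

theorem gradient_mem_unit {u : Fin n → Profile m → ℝ} (hu : ∀ k a, u k a ∈ Set.Icc (0 : ℝ) 1)
    (x : MixedProfile m) (k : Fin n) (l : Fin (m k)) :
    gradient u x k l ∈ Set.Icc (0 : ℝ) 1 := by
  constructor
  · exact Finset.sum_nonneg fun a _ => mul_nonneg (weight_nonneg x a) (hu _ _).1
  · calc gradient u x k l ≤ ∑ a, weight x a * 1 := Finset.sum_le_sum fun a _ =>
          mul_le_mul_of_nonneg_left (hu _ _).2 (weight_nonneg x a)
      _ = 1 := by simp [sum_weight]

theorem utility_update_self (u : Fin n → Profile m → ℝ) (x : MixedProfile m) (k : Fin n)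
    (z : ↥(stdSimplex ℝ (Fin (m k)))) :
    utility u k (Function.update x k z) = ∑ l, z.1 l * gradient u x k l := by
  have hw : ∀ a, weight x a = (x k).1 (a k) * ∏ q ∈ Finset.univ.erase k, (x q).1 (a q) :=
    fun a => by rw [← weight_update, Function.update_eq_self]
  have hR : ∑ l, z.1 l * gradient u x k l
      = ∑ q : Fin (m k) × Profile m, z.1 q.1 * (weight x q.2 * u k (Function.update q.2 k q.1)) := by
    rw [Fintype.sum_prod_type]
    simp only [gradient, Finset.mul_sum]
  have hL : utility u k (Function.update x k z)
      = ∑ q : Fin (m k) × Profile m,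
        (x k).1 q.1 * (weight (Function.update x k z) q.2 * u k q.2) := by
    rw [Fintype.sum_prod_type]
    simp only [← Finset.mul_sum, ← Finset.sum_mul]
    rw [(x k).2.2, one_mul]
    rfl
  rw [hR, hL]
  -- Exchanging the spare action i with the component a_k is an involution of the pairs (i, a), and
  -- it matches the two sums term by term.
  refine Finset.sum_bij' (fun q _ => (q.2 k, Function.update q.2 k q.1))
    (fun q _ => (q.2 k, Function.update q.2 k q.1)) (by simp) (by simp) (by simp) (by simp) ?_
  rintro ⟨i, a⟩ -
  have : ∏ q ∈ Finset.univ.erase k, (x q).1 (Function.update a k i q)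
      = ∏ q ∈ Finset.univ.erase k, (x q).1 (a q) :=
    Finset.prod_congr rfl fun q hq => by rw [Function.update_of_ne (Finset.ne_of_mem_erase hq)]
  simp only [hw, weight_update, Function.update_self, Function.update_idem,
    Function.update_eq_self, this]
  ring

theorem utility_eq_sum_gradient (u : Fin n → Profile m → ℝ) (x : MixedProfile m) (k : Fin n) :
    utility u k x = ∑ l, (x k).1 l * gradient u x k l := by
  rw [← utility_update_self, Function.update_eq_self]

theorem gradient_update_self (u : Fin n → Profile m → ℝ) (x : MixedProfile m) (k : Fin n)
    (z : ↥(stdSimplex ℝ (Fin (m k)))) (l : Fin (m k)) :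
    gradient u (Function.update x k z) k l = gradient u x k l := by
  have h : ∀ y : MixedProfile m, gradient u y k l
      = utility u k (Function.update y k (vertex l)) := fun y => by
    rw [utility_update_self]
    simp [vertex, Pi.single_apply]
  rw [h, h, Function.update_idem]

/-! ### Lipschitz continuity of the loss on interior profiles. -/

theorem sum_sq_tangentProj_sub {d : ℕ} (v w : Fin d → ℝ) :
    ∑ l, tangentProj v l ^ 2 - ∑ l, tangentProj w l ^ 2
      = ∑ l, tangentProj v l * (v l - w l) + ∑ l, tangentProj w l * (v l - w l) := by
  have h1 := sum_mul_tangentProj_tangentProj v v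
  have h2 := sum_mul_tangentProj_tangentProj w w
  have h3 := sum_mul_tangentProj_tangentProj v w
  have h4 := sum_mul_tangentProj_tangentProj w v
  have h5 : ∑ l, tangentProj w l * tangentProj v l = ∑ l, tangentProj v l * tangentProj w l :=
    Finset.sum_congr rfl fun _ _ => mul_comm _ _
  simp only [sq, mul_sub, Finset.sum_sub_distrib]
  linarith

theorem abs_log_sub_log_le {e a b : ℝ} (he : 0 < e) (ha : e ≤ a) (hb : e ≤ b) :
    |Real.log a - Real.log b| ≤ |a - b| / e := by
  have key : ∀ {a b : ℝ}, e ≤ a → e ≤ b → Real.log a - Real.log b ≤ |a - b| / e := by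
    intro a b ha hb
    have ha' := he.trans_le ha
    have hb' := he.trans_le hb
    rw [← Real.log_div ha'.ne' hb'.ne']
    calc Real.log (a / b) ≤ a / b - 1 := Real.log_le_sub_one_of_pos (by positivity)
      _ = (a - b) / b := by field_simp
      _ ≤ |a - b| / b := by gcongr; exact le_abs_self _
      _ ≤ |a - b| / e := by gcongr
  rw [abs_le]
  have h := key hb ha
  rw [abs_sub_comm] at h
  exact ⟨by linarith, key ha hb⟩

theorem action_pos (x : MixedProfile m) (k : Fin n) : 0 < m k := by
  refine Nat.pos_of_ne_zero fun h => ?_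
  have := (x k).2.2
  have : IsEmpty (Fin (m k)) := by rw [h]; infer_instance
  simp_all

theorem le_maxActions (k : Fin n) : m k ≤ maxActions m := Finset.le_sup (Finset.mem_univ k)

theorem log_inv_pos {p : ℝ} (hp : p ∈ Set.Ioo (0 : ℝ) 1) : 0 < Real.log (1 / p) :=
  Real.log_pos (by rw [lt_div_iff₀ hp.1]; linarith [hp.2])

theorem gradRange_ge_two {p : ℝ} (hp : p ∈ Set.Ioo (0 : ℝ) 1) : 2 ≤ gradRange m p := by
  have := div_nonneg (Real.log_natCast_nonneg (maxActions m)) (log_inv_pos hp).le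
  unfold gradRange
  linarith

theorem Lhat_pos {p : ℝ} (hp : p ∈ Set.Ioo (0 : ℝ) 1) (x : MixedProfile m) (hn : 0 < n) :
    0 < Lhat m p := by
  have h1 := log_inv_pos hp
  have h2 := gradRange_ge_two (m := m) hp
  have h3 : 0 < maxActions m := (action_pos x ⟨0, hn⟩).trans_le (le_maxActions _)
  have := hp.1
  unfold Lhat
  have : (0 : ℝ) < maxActions m := by exact_mod_cast h3
  positivity

/-- All action probabilities are at least `p / m*`. -/
def IsInterior (p : ℝ) (x : MixedProfile m) : Prop := ∀ k l, p / maxActions m ≤ (x k).1 l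

theorem maxActions_pos (k : Fin n) (l : Fin (m k)) : (0 : ℝ) < maxActions m := by
  have : 0 < maxActions m := (Nat.zero_lt_of_lt l.2).trans_le (le_maxActions k)
  exact_mod_cast this

theorem IsInterior.pos {p : ℝ} (hp : p ∈ Set.Ioo (0 : ℝ) 1) {x : MixedProfile m}
    (hx : IsInterior p x) (k : Fin n) (l : Fin (m k)) : 0 < (x k).1 l :=
  (div_pos hp.1 (maxActions_pos k l)).trans_le (hx k l)

theorem addEntropy_mem {p : ℝ} (hp : p ∈ Set.Ioo (0 : ℝ) 1) {x : MixedProfile m}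
    (hx : IsInterior p x) {τ : ℝ} (hτ : τ = 1 / Real.log (1 / p)) {g : ∀ k, Fin (m k) → ℝ}
    {k : Fin n} (hg : ∀ l, g k l ∈ Set.Icc (0 : ℝ) 1) (l : Fin (m k)) :
    addEntropy τ x g k l ∈ Set.Icc (-τ) (-τ + gradRange m p) := by
  have hΛ := log_inv_pos hp
  have hm := maxActions_pos k l
  have hτ0 : 0 < τ := by rw [hτ]; positivity
  have hle : Real.log ((x k).1 l) ≤ 0 :=
    Real.log_nonpos (hx.pos hp k l).le (mem_Icc_of_mem_stdSimplex (x k).2 l).2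
  have hge : -Real.log (1 / p) - Real.log (maxActions m) ≤ Real.log ((x k).1 l) := by
    have := Real.log_le_log (div_pos hp.1 hm) (hx k l)
    rw [Real.log_div hp.1.ne' hm.ne'] at this
    rw [one_div, Real.log_inv]
    linarith
  have h1 : τ * (-Real.log (1 / p) - Real.log (maxActions m)) = -(gradRange m p - 1) := by
    rw [hτ, gradRange]
    field_simp
    ring
  have h2 := mul_le_mul_of_nonneg_left hge hτ0.le
  have h3 := mul_nonpos_of_nonneg_of_nonpos hτ0.le hle
  obtain ⟨h4, h5⟩ := hg l
  simp only [addEntropy]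
  constructor <;> linarith

/-- A change of player j's strategy leaves that player's own gradient fixed and moves only the
entropy term; for every other player the entropy term is fixed and the gradient moves linearly. -/
theorem abs_loss_update_sub_le (hn : 0 < n) {u : Fin n → Profile m → ℝ}
    (hu : ∀ k a, u k a ∈ Set.Icc (0 : ℝ) 1) {p : ℝ} (hp : p ∈ Set.Ioo (0 : ℝ) 1) {τ : ℝ}
    (hτ : τ = 1 / Real.log (1 / p)) {η : Fin n → ℝ} (hη : ∀ k, η k = 2 / Lhat m p)
    {x : MixedProfile m} (hx : IsInterior p x) {j : Fin n} {z : ↥(stdSimplex ℝ (Fin (m j)))}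
    (hy : IsInterior p (Function.update x j z)) :
    |loss u η τ (Function.update x j z) - loss u η τ x| ≤ ∑ l, |z.1 l - (x j).1 l| := by
  set y := Function.update x j z with hydef
  set S := ∑ l, |z.1 l - (x j).1 l| with hS
  set ρ := gradRange m p with hρ
  have hρ2 : 2 ≤ ρ := gradRange_ge_two hp
  have hL := Lhat_pos hp x hn
  have hΛ := log_inv_pos hp
  have hτ0 : 0 < τ := by rw [hτ]; positivity
  have hp0 := hp.1
  have hS0 : 0 ≤ S := Finset.sum_nonneg fun _ _ => abs_nonneg _
  set v := fun k => addEntropy τ y (gradient u y) k with hv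
  set w := fun k => addEntropy τ x (gradient u x) k with hw
  have hvm : ∀ k l, v k l ∈ Set.Icc (-τ) (-τ + ρ) := fun k =>
    addEntropy_mem hp hy hτ (gradient_mem_unit hu y k)
  have hwm : ∀ k l, w k l ∈ Set.Icc (-τ) (-τ + ρ) := fun k =>
    addEntropy_mem hp hx hτ (gradient_mem_unit hu x k)
  -- The cost of the entropy term of player j: two inner products, each with |Π·| ≤ ρ m*/4 and
  -- logarithms of Lipschitz constant m*/p. With the gradient costs it makes up exactly L̂/2.
  set E : ℝ := ρ * (maxActions m ^ 2 * τ / p) / 2 with hE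
  have hE0 : 0 ≤ E := by positivity
  have main : ∀ k, |∑ l, tangentProj (v k) l ^ 2 - ∑ l, tangentProj (w k) l ^ 2|
      ≤ (m k * ρ / 2 + if k = j then E else 0) * S := by
    intro k
    rw [sum_sq_tangentProj_sub]
    by_cases hkj : k = j
    · subst hkj
      rw [if_pos rfl]
      have hmk : 0 < (m k : ℝ) := by exact_mod_cast action_pos x k
      have hmk1 : (1 : ℝ) ≤ m k := by exact_mod_cast action_pos x k
      have hms : (m k : ℝ) ≤ maxActions m := by exact_mod_cast le_maxActions k
      have hms0 : 0 < (maxActions m : ℝ) := hmk.trans_le hms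
      -- 1 - 1/m ≤ m/4 amounts to (m - 2)² ≥ 0.
      have hq : 1 - 1 / (m k : ℝ) ≤ maxActions m / 4 := by
        have : 1 - 1 / (m k : ℝ) ≤ m k / 4 := by
          rw [sub_le_iff_le_add, ← sub_le_iff_le_add', le_div_iff₀ hmk]
          nlinarith [sq_nonneg ((m k : ℝ) - 2)]
        linarith
      have hd : ∀ l, |v k l - w k l| ≤ τ * (maxActions m / p) * |z.1 l - (x k).1 l| := by
        intro l
        have h1 : v k l - w k l = -τ * (Real.log (z.1 l) - Real.log ((x k).1 l)) := by
          simp only [hv, hw, addEntropy, hydef, gradient_update_self, Function.update_self]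
          ring
        have hz : p / maxActions m ≤ z.1 l := by
          have := hy k l
          rwa [hydef, Function.update_self] at this
        have h2 := abs_log_sub_log_le (div_pos hp0 hms0) hz (hx k l)
        rw [h1, abs_mul, abs_neg, abs_of_pos hτ0, mul_assoc]
        refine mul_le_mul_of_nonneg_left (h2.trans_eq ?_) hτ0.le
        field_simp
      have hbound : ∀ t : Fin (m k) → ℝ, (∀ l, t l ∈ Set.Icc (-τ) (-τ + ρ)) →
          |∑ l, tangentProj t l * (v k l - w k l)| ≤ E / 2 * S := by
        intro t ht
        refine (Finset.abs_sum_le_sum_abs _ _).trans ?_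
        rw [hS, Finset.mul_sum]
        refine Finset.sum_le_sum fun l _ => ?_
        rw [abs_mul]
        calc |tangentProj t l| * |v k l - w k l|
            ≤ (ρ * (maxActions m / 4)) * (τ * (maxActions m / p) * |z.1 l - (x k).1 l|) := by
              refine mul_le_mul ((abs_tangentProj_le ht l).trans ?_) (hd l) (abs_nonneg _)
                (by positivity)
              exact mul_le_mul_of_nonneg_left hq (by linarith)
          _ = E / 2 * |z.1 l - (x k).1 l| := by rw [hE]; ring
      have h1 := hbound (v k) (hvm k)
      have h2 := hbound (w k) (hwm k)
      have h3 := abs_add_le (∑ l, tangentProj (v k) l * (v k l - w k l))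
        (∑ l, tangentProj (w k) l * (v k l - w k l))
      have h4 : 0 ≤ (m k : ℝ) * ρ / 2 * S := by positivity
      linarith
    · rw [if_neg hkj]
      set H : Fin (m j) → Fin (m k) → ℝ :=
        fun i => gradient u (Function.update x j (vertex i)) k with hH
      have hd : ∀ l, v k l - w k l = ∑ i, (z.1 i - (x j).1 i) * H i l := by
        intro l
        have hgx : gradient u x k l = ∑ i, (x j).1 i * H i l := by
          conv_lhs => rw [← Function.update_eq_self j x]
          exact gradient_update_eq_sum_vertex u x j (x j) k l
        simp only [hv, hw, addEntropy, hydef, Function.update_of_ne hkj]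
        rw [gradient_update_eq_sum_vertex, hgx]
        simp only [sub_mul, Finset.sum_sub_distrib]
        ring
      have hbound : ∀ t : Fin (m k) → ℝ, (∀ l, t l ∈ Set.Icc (-τ) (-τ + ρ)) →
          |∑ l, tangentProj t l * (v k l - w k l)| ≤ m k * ρ / 4 * S := by
        intro t ht
        -- Moving Π back onto the gradients H i, whose entries have range 1, makes the factor 1/4 of
        -- Popoviciu available.
        have h1 : ∑ l, tangentProj t l * (v k l - w k l)
            = ∑ i, (z.1 i - (x j).1 i) * ∑ l, tangentProj t l * tangentProj (H i) l := by
          simp_rw [sum_mul_tangentProj_tangentProj, hd, Finset.mul_sum]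
          rw [Finset.sum_comm]
          exact Finset.sum_congr rfl fun i _ => Finset.sum_congr rfl fun l _ => by ring
        rw [h1]
        refine (Finset.abs_sum_le_sum_abs _ _).trans ?_
        rw [hS, Finset.mul_sum]
        refine Finset.sum_le_sum fun i _ => ?_
        rw [abs_mul, mul_comm]
        refine mul_le_mul_of_nonneg_right ?_ (abs_nonneg _)
        have := abs_sum_tangentProj_mul_le (b := 0) (ρ' := 1) (by linarith) zero_le_one ht
          (w := H i) (fun l => by rw [zero_add]; exact gradient_mem_unit hu _ k l)
        simpa using this
      have h1 := hbound (v k) (hvm k)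
      have h2 := hbound (w k) (hwm k)
      have h3 := abs_add_le (∑ l, tangentProj (v k) l * (v k l - w k l))
        (∑ l, tangentProj (w k) l * (v k l - w k l))
      linarith
  have hdiff : loss u η τ y - loss u η τ x
      = 2 / Lhat m p * ∑ k, (∑ l, tangentProj (v k) l ^ 2 - ∑ l, tangentProj (w k) l ^ 2) := by
    simp only [loss, hη, ← Finset.mul_sum, Finset.sum_sub_distrib, mul_sub, hv, hw]
  rw [hdiff, abs_mul, abs_of_pos (div_pos two_pos hL)]
  calc 2 / Lhat m p * |∑ k, (∑ l, tangentProj (v k) l ^ 2 - ∑ l, tangentProj (w k) l ^ 2)|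
      ≤ 2 / Lhat m p * ∑ k, (m k * ρ / 2 + if k = j then E else 0) * S := by
        gcongr
        exact (Finset.abs_sum_le_sum_abs _ _).trans (Finset.sum_le_sum fun k _ => main k)
    _ = 2 / Lhat m p * ((totalActions m * ρ / 2 + E) * S) := by
        rw [← Finset.sum_mul, Finset.sum_add_distrib, Finset.sum_ite_eq' Finset.univ j,
          if_pos (Finset.mem_univ j), ← Finset.sum_div, ← Finset.sum_mul, totalActions]
        push_cast
        ring
    _ = S := by
        have : totalActions m * ρ / 2 + E = Lhat m p / 2 := by
          rw [hE, Lhat, ← hρ, hτ]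
          field_simp
          ring
        rw [this]
        field_simp

/-- Hybrid argument: pass from y to x one player at a time. Each hybrid is again interior, because
interiority is a condition on each player separately. -/
theorem abs_loss_sub_le (hn : 0 < n) {u : Fin n → Profile m → ℝ}
    (hu : ∀ k a, u k a ∈ Set.Icc (0 : ℝ) 1) {p : ℝ} (hp : p ∈ Set.Ioo (0 : ℝ) 1) {τ : ℝ}
    (hτ : τ = 1 / Real.log (1 / p)) {η : Fin n → ℝ} (hη : ∀ k, η k = 2 / Lhat m p)
    {x y : MixedProfile m} (hx : IsInterior p x) (hy : IsInterior p y) :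
    |loss u η τ x - loss u η τ y| ≤ ∑ k, ∑ l, |(x k).1 l - (y k).1 l| := by
  classical
  have hI : ∀ s : Finset (Fin n), IsInterior p (s.piecewise x y) := by
    intro s k l
    by_cases hk : k ∈ s
    · rw [Finset.piecewise_eq_of_mem _ _ _ hk]; exact hx k l
    · rw [Finset.piecewise_eq_of_notMem _ _ _ hk]; exact hy k l
  have key : ∀ s : Finset (Fin n), |loss u η τ (s.piecewise x y) - loss u η τ y|
      ≤ ∑ k ∈ s, ∑ l, |(x k).1 l - (y k).1 l| := by
    intro s
    induction s using Finset.induction_on with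
    | empty => simp
    | insert j s hj ih =>
      have h := abs_loss_update_sub_le hn hu hp hτ hη (hI s) (j := j) (z := x j)
        (by rw [← Finset.piecewise_insert]; exact hI _)
      rw [Finset.piecewise_eq_of_notMem _ _ _ hj] at h
      rw [Finset.piecewise_insert, Finset.sum_insert hj]
      refine (abs_sub_le _ (loss u η τ (s.piecewise x y)) _).trans ?_
      linarith
  simpa using key Finset.univ

/-! ### Range of the loss estimate. -/

/-- The value of the one-shot loss estimate for given gradient estimates. -/
noncomputable def sampleValue (η : Fin n → ℝ) (τ : ℝ) (x : MixedProfile m)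
    (g g' : ∀ k, Fin (m k) → ℝ) : ℝ :=
  ∑ k, η k * ∑ l, tangentProj (addEntropy τ x g k) l * tangentProj (addEntropy τ x g' k) l

theorem abs_sampleValue_le {p : ℝ} (hp : p ∈ Set.Ioo (0 : ℝ) 1) (hn : 0 < n)
    {x : MixedProfile m} (hx : IsInterior p x) {τ : ℝ} (hτ : τ = 1 / Real.log (1 / p))
    {η : Fin n → ℝ} (hη : ∀ k, η k = 2 / Lhat m p) {g g' : ∀ k, Fin (m k) → ℝ}
    (hg : ∀ k l, g k l ∈ Set.Icc (0 : ℝ) 1) (hg' : ∀ k l, g' k l ∈ Set.Icc (0 : ℝ) 1) :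
    |sampleValue η τ x g g'| ≤ rangeBound m p / 2 := by
  have hρ : 0 ≤ gradRange m p := zero_le_two.trans (gradRange_ge_two hp)
  have hL := Lhat_pos hp x hn
  calc |sampleValue η τ x g g'|
      ≤ ∑ k, 2 / Lhat m p * (m k * (gradRange m p * gradRange m p) / 4) := by
        refine (Finset.abs_sum_le_sum_abs _ _).trans (Finset.sum_le_sum fun k _ => ?_)
        rw [hη, abs_mul, abs_of_pos (div_pos two_pos hL)]
        gcongr
        exact abs_sum_tangentProj_mul_le hρ hρ (addEntropy_mem hp hx hτ (hg k))
          (addEntropy_mem hp hx hτ (hg' k))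
    _ = rangeBound m p / 2 := by
        rw [← Finset.mul_sum, ← Finset.sum_div, ← Finset.sum_mul, rangeBound, totalActions]
        push_cast
        ring

theorem mem_support_lossSample {u : Fin n → Profile m → ℝ} {est : GradientEstimator u}
    {η : Fin n → ℝ} {τ : ℝ} {x : MixedProfile m} {y : ℝ}
    (hy : y ∈ (lossSample est η τ x).support) :
    ∃ g g', (∀ k l, g k l ∈ Set.Icc (0 : ℝ) 1) ∧ (∀ k l, g' k l ∈ Set.Icc (0 : ℝ) 1) ∧
      y = sampleValue η τ x g g' := by
  simp only [lossSample, PMF.mem_support_bind_iff, PMF.mem_support_map_iff] at hy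
  obtain ⟨g, hg, g', hg', rfl⟩ := hy
  exact ⟨g, g', est.mem_unit x g hg, est.mem_unit x g' hg', rfl⟩

/-! ### The loss at equilibrium, and exploitability in terms of the loss. -/

theorem loss_nonneg {u : Fin n → Profile m → ℝ} {η : Fin n → ℝ} (hη : ∀ k, 0 ≤ η k) (τ : ℝ)
    (x : MixedProfile m) : 0 ≤ loss u η τ x :=
  Finset.sum_nonneg fun k _ => mul_nonneg (hη k) (Finset.sum_nonneg fun _ _ => sq_nonneg _)

/-- At a softmax profile ∇_k - τ ln x_k is constant, namely τ times the log-partition function, and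
Π kills constants. -/
theorem loss_eq_zero_of_isQRE {u : Fin n → Profile m → ℝ} {η : Fin n → ℝ} {τ : ℝ} (hτ : τ ≠ 0)
    {x : MixedProfile m} (hx : IsQRE u τ x) : loss u η τ x = 0 := by
  refine Finset.sum_eq_zero fun k _ => ?_
  have h : addEntropy τ x (gradient u x) k = fun l => (0 : Fin (m k) → ℝ) l
      + τ * (Real.log (∑ j, Real.exp (gradient u x k j / τ)) - 1) := by
    funext l
    have : 0 < ∑ j, Real.exp (gradient u x k j / τ) :=
      Finset.sum_pos (fun _ _ => Real.exp_pos _) ⟨l, Finset.mem_univ l⟩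
    simp only [addEntropy]
    rw [hx k l, Real.log_div (Real.exp_pos _).ne' this.ne', Real.log_exp]
    simp only [Pi.zero_apply]
    field_simp
    ring
  rw [h, tangentProj_add_const]
  simp [tangentProj]

/-- Gibbs' inequality against the uniform distribution, from ln t ≤ t - 1 at t = 1/(d x_l). -/
theorem neg_sum_mul_log_le {d : ℕ} (x : ↥(stdSimplex ℝ (Fin d))) (hx : ∀ l, 0 < x.1 l) :
    -∑ l, x.1 l * Real.log (x.1 l) ≤ Real.log d := by
  have hd : 0 < d := by
    refine Nat.pos_of_ne_zero ?_
    rintro rfl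
    simpa using x.2.2
  have hd' : (0 : ℝ) < d := by exact_mod_cast hd
  have h : ∀ l, -(x.1 l * Real.log (x.1 l)) ≤ x.1 l * Real.log d + (1 / d - x.1 l) := by
    intro l
    have h1 := Real.log_le_sub_one_of_pos (x := 1 / (x.1 l * d)) (by have := hx l; positivity)
    rw [one_div, Real.log_inv, Real.log_mul (hx l).ne' hd'.ne'] at h1
    have h2 := mul_le_mul_of_nonneg_left h1 (hx l).le
    have h3 : x.1 l * ((x.1 l * d)⁻¹ - 1) = 1 / d - x.1 l := by
      have := (hx l).ne'
      field_simp
    linarith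
  rw [← Finset.sum_neg_distrib]
  refine (Finset.sum_le_sum fun l _ => h l).trans_eq ?_
  rw [Finset.sum_add_distrib, ← Finset.sum_mul, Finset.sum_sub_distrib, x.2.2]
  simp
  field_simp
  ring

theorem sum_sq_sub_le_two {d : ℕ} (x z : ↥(stdSimplex ℝ (Fin d))) :
    ∑ l, (z.1 l - x.1 l) ^ 2 ≤ 2 := by
  have : ∀ l, (z.1 l - x.1 l) ^ 2 ≤ z.1 l + x.1 l := fun l => by
    obtain ⟨h1, h2⟩ := mem_Icc_of_mem_stdSimplex x.2 l
    obtain ⟨h3, h4⟩ := mem_Icc_of_mem_stdSimplex z.2 l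
    nlinarith [mul_nonneg h1 h3]
  refine (Finset.sum_le_sum fun l _ => this l).trans_eq ?_
  rw [Finset.sum_add_distrib, x.2.2, z.2.2]
  norm_num

/-- The gain of a deviation z splits into ⟨z - x_k, Π∇^τ⟩, where Π is free because z - x_k sums to
zero, and an entropy part of at most τ ln m_k. Cauchy-Schwarz with ‖z - x_k‖² ≤ 2 and ‖Π∇^τ‖² ≤
(L̂/2) · loss bounds the first. -/
theorem exploitability_le (hn : 0 < n) (u : Fin n → Profile m → ℝ)
    {p : ℝ} (hp : p ∈ Set.Ioo (0 : ℝ) 1) {τ : ℝ}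
    (hτ : 0 ≤ τ) {η : Fin n → ℝ} (hη : ∀ k, η k = 2 / Lhat m p)
    {x : MixedProfile m} (hx : IsInterior p x) :
    exploitability u x
      ≤ τ * Real.log ((∏ k, m k : ℕ) : ℝ) + √(Lhat m p * loss u η τ x) := by
  have hL := Lhat_pos hp x hn
  have : Nonempty (Fin n) := ⟨⟨0, hn⟩⟩
  refine ciSup_le fun k => ?_
  have : Nonempty ↥(stdSimplex ℝ (Fin (m k))) := ⟨x k⟩
  rw [playerExploitability, sub_le_iff_le_add]
  refine ciSup_le fun z => ?_
  rw [← sub_le_iff_le_add, utility_update_self, utility_eq_sum_gradient u x k]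
  set w := addEntropy τ x (gradient u x) k with hw
  have hsplit : ∑ l, z.1 l * gradient u x k l - ∑ l, (x k).1 l * gradient u x k l
      = ∑ l, (z.1 l - (x k).1 l) * tangentProj w l
        + τ * (∑ l, z.1 l * Real.log ((x k).1 l) - ∑ l, (x k).1 l * Real.log ((x k).1 l)) := by
    have h0 : ∑ l, (z.1 l - (x k).1 l) = 0 := by
      rw [Finset.sum_sub_distrib, z.2.2, (x k).2.2, sub_self]
    have h1 : ∀ l, (z.1 l - (x k).1 l) * tangentProj w l
        = z.1 l * gradient u x k l - (x k).1 l * gradient u x k l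
          - τ * (z.1 l * Real.log ((x k).1 l) - (x k).1 l * Real.log ((x k).1 l))
          - (z.1 l - (x k).1 l) * (τ + (∑ j, w j) / m k) := fun l => by
      simp only [tangentProj, hw, addEntropy]
      ring
    simp only [h1, Finset.sum_sub_distrib, ← Finset.sum_mul, ← Finset.mul_sum] at h0 ⊢
    rw [h0]
    ring
  have hzlog : ∑ l, z.1 l * Real.log ((x k).1 l) ≤ 0 :=
    Finset.sum_nonpos fun l _ => mul_nonpos_of_nonneg_of_nonpos (z.2.1 l)
      (Real.log_nonpos (hx.pos hp k l).le (mem_Icc_of_mem_stdSimplex (x k).2 l).2)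
  have hent := neg_sum_mul_log_le (x k) (hx.pos hp k)
  have hmle : Real.log (m k) ≤ Real.log ((∏ k, m k : ℕ) : ℝ) := by
    refine Real.log_le_log (by exact_mod_cast action_pos x k) ?_
    exact_mod_cast Nat.le_of_dvd (Finset.prod_pos fun j _ => action_pos x j)
      (Finset.dvd_prod_of_mem m (Finset.mem_univ k))
  have hτm := mul_le_mul_of_nonneg_left
    (show ∑ l, z.1 l * Real.log ((x k).1 l) - ∑ l, (x k).1 l * Real.log ((x k).1 l)
      ≤ Real.log ((∏ k, m k : ℕ) : ℝ) by linarith) hτ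
  have hlin : ∑ l, (z.1 l - (x k).1 l) * tangentProj w l ≤ √(Lhat m p * loss u η τ x) := by
    refine Real.le_sqrt_of_sq_le ?_
    have hk : ∑ l, tangentProj w l ^ 2 ≤ Lhat m p / 2 * loss u η τ x := by
      have h1 : η k * ∑ l, tangentProj w l ^ 2 ≤ loss u η τ x :=
        Finset.single_le_sum (f := fun k => η k * ∑ l, tangentProj
          (addEntropy τ x (gradient u x) k) l ^ 2) (fun j _ => mul_nonneg (by rw [hη]; positivity)
          (Finset.sum_nonneg fun _ _ => sq_nonneg _)) (Finset.mem_univ k)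
      rw [hη] at h1
      have h2 := mul_le_mul_of_nonneg_left h1 (by positivity : 0 ≤ Lhat m p / 2)
      refine le_trans (le_of_eq ?_) h2
      field_simp
    calc _ ≤ (∑ l, (z.1 l - (x k).1 l) ^ 2) * ∑ l, tangentProj w l ^ 2 :=
          Finset.sum_mul_sq_le_sq_mul_sq _ _ _
      _ ≤ 2 * (Lhat m p / 2 * loss u η τ x) := by
          refine mul_le_mul (sum_sq_sub_le_two _ _) hk
            (Finset.sum_nonneg fun _ _ => sq_nonneg _) zero_le_two
      _ = _ := by ring
  linarith


/-! ### Discrete distributions: union bound, expectation, Hoeffding's lemma. -/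

section PMF
variable {α β : Type*}

theorem pmf_toOuterMeasure_le_one (p : PMF α) (s : Set α) : p.toOuterMeasure s ≤ 1 := by
  rw [PMF.toOuterMeasure_apply, ← p.tsum_coe]
  exact ENNReal.tsum_le_tsum fun x => Set.indicator_le_self _ _ x

/-- The union bound for a two-stage experiment: either the first stage leaves the good set, or the
second fails from a good state. It drives the inductions over cubes and over batches. -/
theorem pmf_toOuterMeasure_bind_le {p : PMF α} {q : α → PMF β} {G : Set α} {S : Set β}
    {a b : ℝ≥0∞} (ha : p.toOuterMeasure Gᶜ ≤ a)
    (hb : ∀ x ∈ p.support, x ∈ G → (q x).toOuterMeasure S ≤ b) :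
    (p.bind q).toOuterMeasure S ≤ a + b := by
  rw [PMF.toOuterMeasure_bind_apply]
  calc ∑' x, p x * (q x).toOuterMeasure S ≤ ∑' x, (Gᶜ.indicator p x + p x * b) := by
        refine ENNReal.tsum_le_tsum fun x => ?_
        by_cases hx : x ∈ G
        · by_cases hs : x ∈ p.support
          · exact (mul_le_mul_right (hb x hs hx) _).trans le_add_self
          · rw [(p.apply_eq_zero_iff x).2 hs]; simp
        · rw [Set.indicator_of_mem (by exact hx)]
          exact (mul_le_of_le_one_right' (pmf_toOuterMeasure_le_one _ _)).trans le_self_add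
    _ = p.toOuterMeasure Gᶜ + b := by
        rw [ENNReal.tsum_add, ENNReal.tsum_mul_right, p.tsum_coe, one_mul,
          PMF.toOuterMeasure_apply]
    _ ≤ a + b := add_le_add_left ha b

theorem pmf_one_le_add_compl (p : PMF α) (s : Set α) :
    1 ≤ p.toOuterMeasure s + p.toOuterMeasure sᶜ := by
  rw [← (PMF.toOuterMeasure_apply_eq_one_iff p Set.univ).2 (Set.subset_univ _),
    ← Set.union_compl_self s]
  exact MeasureTheory.measure_union_le _ _

theorem pmf_tsum_bind_mul (p : PMF α) (q : α → PMF β) (g : β → ℝ≥0∞) :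
    ∑' b, p.bind q b * g b = ∑' a, p a * ∑' b, q a b * g b := by
  simp only [PMF.bind_apply, ← ENNReal.tsum_mul_right, ← ENNReal.tsum_mul_left]
  rw [ENNReal.tsum_comm]
  simp only [mul_assoc]

theorem pmf_tsum_pure_mul (a : α) (g : α → ℝ≥0∞) : ∑' b, PMF.pure a b * g b = g a := by
  rw [tsum_eq_single a fun b hb => by rw [PMF.pure_apply_of_ne _ _ hb, zero_mul]]
  rw [PMF.pure_apply_self, one_mul]

theorem pmf_tsum_map_mul (p : PMF α) (f : α → β) (g : β → ℝ≥0∞) :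
    ∑' b, p.map f b * g b = ∑' a, p a * g (f a) := by
  rw [PMF.map, pmf_tsum_bind_mul]
  simp only [Function.comp_apply, pmf_tsum_pure_mul]

theorem pmf_toOuterMeasure_le_tsum_mul (p : PMF α) {S : Set α} {g : α → ℝ≥0∞}
    (hg : ∀ x ∈ p.support, x ∈ S → 1 ≤ g x) : p.toOuterMeasure S ≤ ∑' a, p a * g a := by
  rw [PMF.toOuterMeasure_apply]
  refine ENNReal.tsum_le_tsum fun x => ?_
  by_cases hx : x ∈ S
  · rw [Set.indicator_of_mem hx]
    by_cases hs : x ∈ p.support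
    · exact le_mul_of_one_le_right' (hg x hs hx)
    · rw [(p.apply_eq_zero_iff x).2 hs]; simp
  · rw [Set.indicator_of_notMem hx]; exact zero_le

/-- The expectation of a real function under a discrete distribution. -/
noncomputable def expect (p : PMF α) (f : α → ℝ) : ℝ := ∑' a, (p a).toReal * f a

theorem pmf_summable_toReal (p : PMF α) : Summable fun a => (p a).toReal :=
  ENNReal.summable_toReal p.tsum_coe_ne_top

theorem pmf_tsum_toReal (p : PMF α) : ∑' a, (p a).toReal = 1 := by
  rw [← ENNReal.tsum_toReal_eq p.apply_ne_top, p.tsum_coe, ENNReal.toReal_one]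

theorem pmf_norm_toReal_mul_le {p : PMF α} {f : α → ℝ} {B : ℝ}
    (hf : ∀ a ∈ p.support, |f a| ≤ B) (a : α) :
    ‖(p a).toReal * f a‖ ≤ (p a).toReal * B := by
  by_cases ha : a ∈ p.support
  · rw [norm_mul, Real.norm_of_nonneg ENNReal.toReal_nonneg]
    exact mul_le_mul_of_nonneg_left (hf a ha) ENNReal.toReal_nonneg
  · rw [(p.apply_eq_zero_iff a).2 ha]; simp

theorem pmf_summable_mul {p : PMF α} {f : α → ℝ} {B : ℝ} (hf : ∀ a ∈ p.support, |f a| ≤ B) :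
    Summable fun a => (p a).toReal * f a :=
  Summable.of_norm_bounded ((pmf_summable_toReal p).mul_right B) (pmf_norm_toReal_mul_le hf)

theorem expect_bind {p : PMF α} {q : α → PMF β} {f : β → ℝ} {B : ℝ}
    (hf : ∀ a ∈ p.support, ∀ b ∈ (q a).support, |f b| ≤ B) :
    expect (p.bind q) f = expect p fun a => expect (q a) f := by
  have hsum : Summable fun x : α × β => (p x.1 * q x.1 x.2).toReal := by
    refine ENNReal.summable_toReal ?_
    rw [ENNReal.tsum_prod (f := fun a b => p a * q a b)]
    simp only [ENNReal.tsum_mul_left, PMF.tsum_coe, mul_one]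
    exact ENNReal.one_ne_top
  have hsum' : Summable (Function.uncurry fun a b => (p a).toReal * ((q a b).toReal * f b)) := by
    refine Summable.of_norm_bounded (hsum.mul_right B) ?_
    rintro ⟨a, b⟩
    by_cases ha : a ∈ p.support
    · simp only [Function.uncurry_apply_pair, norm_mul, ENNReal.toReal_mul, mul_assoc,
        Real.norm_of_nonneg ENNReal.toReal_nonneg]
      refine mul_le_mul_of_nonneg_left ?_ ENNReal.toReal_nonneg
      have := pmf_norm_toReal_mul_le (hf a ha) b
      rwa [norm_mul, Real.norm_of_nonneg ENNReal.toReal_nonneg] at this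
    · simp [(p.apply_eq_zero_iff a).2 ha]
  simp only [expect, ← tsum_mul_left]
  rw [← Summable.tsum_comm hsum']
  refine tsum_congr fun b => ?_
  rw [PMF.bind_apply, ENNReal.tsum_toReal_eq fun a =>
    ENNReal.mul_ne_top (p.apply_ne_top a) ((q a).apply_ne_top b), ← tsum_mul_right]
  simp only [ENNReal.toReal_mul, mul_assoc]

theorem expect_map {p : PMF α} {g : α → β} {f : β → ℝ} {B : ℝ}
    (hf : ∀ a ∈ p.support, |f (g a)| ≤ B) :
    expect (p.map g) f = expect p fun a => f (g a) := by
  rw [PMF.map, expect_bind (B := B)]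
  · congr 1
    funext a
    rw [expect, tsum_eq_single (g a)]
    · simp
    · intro b hb
      simp [PMF.pure_apply_of_ne _ _ hb]
  · intro a ha b hb
    simp only [Function.comp_apply, PMF.mem_support_pure_iff] at hb
    exact hb ▸ hf a ha

theorem expect_congr {p : PMF α} {f g : α → ℝ} (h : ∀ a ∈ p.support, f a = g a) :
    expect p f = expect p g := by
  refine tsum_congr fun a => ?_
  by_cases ha : a ∈ p.support
  · rw [h a ha]
  · rw [(p.apply_eq_zero_iff a).2 ha]; simp

theorem expect_const (p : PMF α) (t : ℝ) : expect p (fun _ => t) = t := by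
  rw [expect, tsum_mul_right, pmf_tsum_toReal, one_mul]

theorem expect_finset_sum {ι : Type*} {p : PMF α} (s : Finset ι) {f : ι → α → ℝ} {B : ι → ℝ}
    (hf : ∀ i ∈ s, ∀ a ∈ p.support, |f i a| ≤ B i) :
    expect p (fun a => ∑ i ∈ s, f i a) = ∑ i ∈ s, expect p (f i) := by
  simp only [expect, Finset.mul_sum]
  exact Summable.tsum_finsetSum fun i hi => pmf_summable_mul (hf i hi)

theorem expect_mul_left (p : PMF α) (t : ℝ) (f : α → ℝ) :
    expect p (fun a => t * f a) = t * expect p f := by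
  simp only [expect, ← tsum_mul_left]
  exact tsum_congr fun a => by ring

theorem expect_sub {p : PMF α} {f g : α → ℝ} {B C : ℝ} (hf : ∀ a ∈ p.support, |f a| ≤ B)
    (hg : ∀ a ∈ p.support, |g a| ≤ C) :
    expect p (fun a => f a - g a) = expect p f - expect p g := by
  simp only [expect, mul_sub]
  exact Summable.tsum_sub (pmf_summable_mul hf) (pmf_summable_mul hg)

theorem expect_mem_Icc {p : PMF α} {f : α → ℝ} {a b : ℝ}
    (hf : ∀ x ∈ p.support, f x ∈ Set.Icc a b) : expect p f ∈ Set.Icc a b := by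
  have hB : ∀ x ∈ p.support, |f x| ≤ max |a| |b| := fun x hx =>
    abs_le_max_abs_abs (hf x hx).1 (hf x hx).2
  have hle : ∀ {g h : α → ℝ} {B C : ℝ}, (∀ x ∈ p.support, |g x| ≤ B) →
      (∀ x ∈ p.support, |h x| ≤ C) → (∀ x ∈ p.support, g x ≤ h x) →
      expect p g ≤ expect p h := fun hg hh hgh =>
    Summable.tsum_le_tsum (fun x => by
      by_cases hx : x ∈ p.support
      · exact mul_le_mul_of_nonneg_left (hgh x hx) ENNReal.toReal_nonneg
      · rw [(p.apply_eq_zero_iff x).2 hx]; simp) (pmf_summable_mul hg) (pmf_summable_mul hh)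
  constructor
  · rw [← expect_const p a]
    exact hle (fun _ _ => le_rfl) hB fun x hx => (hf x hx).1
  · rw [← expect_const p b]
    exact hle hB (fun _ _ => le_rfl) fun x hx => (hf x hx).2

/-- Hoeffding's lemma for a discrete distribution. -/
theorem pmf_hoeffding {p : PMF ℝ} {a c : ℝ} (hc : 0 ≤ c)
    (hp : ∀ y ∈ p.support, y ∈ Set.Icc a (a + c)) (s : ℝ) :
    ∑' y, p y * ENNReal.ofReal (Real.exp (s * (y - expect p id)))
      ≤ ENNReal.ofReal (Real.exp (s ^ 2 * c ^ 2 / 8)) := by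
  have hae : ∀ᵐ y ∂p.toMeasure, id y ∈ Set.Icc a (a + c) := by
    rw [MeasureTheory.ae_iff, PMF.toMeasure_apply_eq_toOuterMeasure_apply _ (by
      exact measurableSet_Icc.compl), PMF.toOuterMeasure_apply_eq_zero_iff,
      Set.disjoint_left]
    intro y hy h
    exact h (hp y hy)
  have hint : ∫ y, id y ∂p.toMeasure = expect p id :=
    PMF.integral_eq_tsum p _ (MeasureTheory.Integrable.of_mem_Icc a (a + c)
      measurable_id.aemeasurable hae)
  have hsub := ProbabilityTheory.hasSubgaussianMGF_of_mem_Icc measurable_id.aemeasurable hae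
  rw [hint] at hsub
  have hmgf := hsub.mgf_le s
  rw [ProbabilityTheory.mgf, PMF.integral_eq_tsum p _ (hsub.integrable_exp_mul s)] at hmgf
  have hB : ∀ y ∈ p.support, |Real.exp (s * (y - expect p id))|
      ≤ Real.exp (|s| * c) := by
    intro y hy
    rw [abs_of_pos (Real.exp_pos _)]
    refine Real.exp_le_exp.2 ((le_abs_self _).trans ?_)
    rw [abs_mul]
    refine mul_le_mul_of_nonneg_left ?_ (abs_nonneg s)
    have h1 := hp y hy
    have h2 := expect_mem_Icc (f := id) hp
    rw [abs_le]
    constructor <;> linarith [h1.1, h1.2, h2.1, h2.2]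
  have heq : ∑' y, p y * ENNReal.ofReal (Real.exp (s * (y - expect p id)))
      = ENNReal.ofReal (∑' y, (p y).toReal * Real.exp (s * (y - expect p id))) := by
    rw [ENNReal.ofReal_tsum_of_nonneg (fun y => by positivity) (pmf_summable_mul hB)]
    refine tsum_congr fun y => ?_
    rw [ENNReal.ofReal_mul ENNReal.toReal_nonneg, ENNReal.ofReal_toReal (p.apply_ne_top y)]
  rw [heq]
  refine ENNReal.ofReal_le_ofReal (hmgf.trans_eq ?_)
  congr 1
  -- The sub-Gaussian parameter is (c/2)², whence the exponent s²c²/8.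
  have : ((‖a + c - a‖₊ / 2 : NNReal) : ℝ) = c / 2 := by
    simp [abs_of_nonneg hc]
  push_cast at this ⊢
  rw [this]
  ring

end PMF

/-! ### Concentration of the average reward of a list of arms. -/

section Pull
variable {d : ℕ} {reward : Arm d → PMF ℝ}

theorem map_fst_of_mem_support_pullAll {zs : List (Arm d)} {o : List (Arm d × ℝ)}
    (ho : o ∈ (pullAll reward zs).support) : o.map Prod.fst = zs := by
  induction zs generalizing o with
  | nil => simp_all [pullAll]
  | cons z zs ih =>
    simp only [pullAll, PMF.mem_support_bind_iff, PMF.mem_support_map_iff] at ho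
    obtain ⟨y, -, o', ho', rfl⟩ := ho
    simp [ih ho']

/-- The list of arms is fixed before any of its rewards is seen, so the exponential moment
factorizes over the pulls. -/
theorem tsum_pullAll_mul_exp_le {a c : ℝ} (hc : 0 ≤ c)
    (hr : ∀ z, ∀ y ∈ (reward z).support, y ∈ Set.Icc a (a + c)) (s : ℝ) (zs : List (Arm d)) :
    ∑' o, pullAll reward zs o * ENNReal.ofReal (Real.exp
        (s * ((o.map Prod.snd).sum - (zs.map fun z => expect (reward z) id).sum)))
      ≤ ENNReal.ofReal (Real.exp (s ^ 2 * c ^ 2 / 8)) ^ zs.length := by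
  induction zs with
  | nil => simp [pullAll]
  | cons z zs ih =>
    rw [pullAll, pmf_tsum_bind_mul]
    simp only [pmf_tsum_map_mul]
    set E := ENNReal.ofReal (Real.exp (s ^ 2 * c ^ 2 / 8)) with hE
    have hfac : ∀ (y : ℝ) (o : List (Arm d × ℝ)), ENNReal.ofReal (Real.exp
        (s * ((((z, y) :: o).map Prod.snd).sum
          - ((z :: zs).map fun z => expect (reward z) id).sum)))
        = ENNReal.ofReal (Real.exp (s * (y - expect (reward z) id))) * ENNReal.ofReal (Real.exp
        (s * ((o.map Prod.snd).sum - (zs.map fun z => expect (reward z) id).sum))) := by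
      intro y o
      rw [← ENNReal.ofReal_mul (Real.exp_pos _).le, ← Real.exp_add]
      simp only [List.map_cons, List.sum_cons]
      congr 2
      ring
    calc _ = ∑' y, reward z y * ENNReal.ofReal (Real.exp (s * (y - expect (reward z) id))) *
          ∑' o, pullAll reward zs o * ENNReal.ofReal (Real.exp
        (s * ((o.map Prod.snd).sum - (zs.map fun z => expect (reward z) id).sum))) := by
          refine tsum_congr fun y => ?_
          rw [mul_assoc, ← ENNReal.tsum_mul_left (a := ENNReal.ofReal _)]
          congr 1
          refine tsum_congr fun o => ?_
          rw [hfac, mul_left_comm]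
      _ ≤ E * E ^ zs.length := by
          rw [ENNReal.tsum_mul_right]
          exact mul_le_mul' (pmf_hoeffding hc (hr z) s) ih
      _ = _ := by rw [List.length_cons, pow_succ']

/-- Hoeffding's inequality for the average reward of a nonempty list of arms. -/
theorem toOuterMeasure_pullAll_le {a c : ℝ} (hc : 0 < c)
    (hr : ∀ z, ∀ y ∈ (reward z).support, y ∈ Set.Icc a (a + c)) {zs : List (Arm d)}
    (hzs : zs ≠ []) {t : ℝ} (ht : 0 ≤ t) :
    (pullAll reward zs).toOuterMeasure {o | ¬ |meanReward o
        - (zs.map fun z => expect (reward z) id).sum / zs.length| < t}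
      ≤ ENNReal.ofReal (2 * Real.exp (-2 * zs.length * t ^ 2 / c ^ 2)) := by
  set N := zs.length with hN
  have hN0 : 0 < (N : ℝ) := by exact_mod_cast List.length_pos_iff.2 hzs
  set D : List (Arm d × ℝ) → ℝ :=
    fun o => (o.map Prod.snd).sum - (zs.map fun z => expect (reward z) id).sum with hD
  -- Chernoff's bound at s = ±4t/c², the minimizer of N s²c²/8 - |s| N t; the two signs give the two
  -- tails.
  have key : ∀ s : ℝ, s ^ 2 = (4 * t / c ^ 2) ^ 2 →
      (pullAll reward zs).toOuterMeasure {o | 4 * t / c ^ 2 * (N * t) ≤ s * D o}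
        ≤ ENNReal.ofReal (Real.exp (-2 * N * t ^ 2 / c ^ 2)) := by
    intro s hs
    have h1 := pmf_toOuterMeasure_le_tsum_mul (pullAll reward zs)
      (S := {o | 4 * t / c ^ 2 * (N * t) ≤ s * D o})
      (g := fun o => ENNReal.ofReal (Real.exp (-(4 * t / c ^ 2 * (N * t)))) *
        ENNReal.ofReal (Real.exp (s * D o))) (by
        intro o _ ho
        rw [← ENNReal.ofReal_mul (Real.exp_pos _).le, ← Real.exp_add, ← ENNReal.ofReal_one]
        refine ENNReal.ofReal_le_ofReal (Real.one_le_exp ?_)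
        have : 4 * t / c ^ 2 * (N * t) ≤ s * D o := ho
        linarith)
    refine h1.trans ?_
    simp only [mul_left_comm _ (ENNReal.ofReal (Real.exp (-(4 * t / c ^ 2 * (N * t)))))]
    rw [ENNReal.tsum_mul_left]
    refine (mul_le_mul_right (tsum_pullAll_mul_exp_le hc.le hr s zs) _).trans ?_
    rw [← ENNReal.ofReal_pow (Real.exp_pos _).le, ← ENNReal.ofReal_mul (Real.exp_pos _).le,
      ← Real.exp_nat_mul, ← Real.exp_add, hs]
    refine ENNReal.ofReal_le_ofReal (Real.exp_le_exp.2 (le_of_eq ?_))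
    field_simp
    ring
  have hsub : {o | ¬ |meanReward o
        - (zs.map fun z => expect (reward z) id).sum / zs.length| < t}
        ∩ (pullAll reward zs).support ⊆
      {o | 4 * t / c ^ 2 * (N * t) ≤ (4 * t / c ^ 2) * D o} ∪
      {o | 4 * t / c ^ 2 * (N * t) ≤ (-(4 * t / c ^ 2)) * D o} := by
    rintro o ⟨ho, hs⟩
    have hlen : o.length = N := by
      rw [hN, ← map_fst_of_mem_support_pullAll hs, List.length_map]
    simp only [Set.mem_ofPred_eq, not_lt, meanReward, hlen, ← hN, ← sub_div] at ho
    rw [abs_div, abs_of_pos hN0, le_div_iff₀ hN0] at ho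
    have hq : 0 ≤ 4 * t / c ^ 2 := by positivity
    rcases le_abs'.1 ho with h | h
    · right
      change 4 * t / c ^ 2 * (N * t) ≤ -(4 * t / c ^ 2) * D o
      rw [neg_mul, ← mul_neg]
      exact mul_le_mul_of_nonneg_left (by simp only [hD]; linarith) hq
    · left
      exact mul_le_mul_of_nonneg_left (by simp only [hD]; linarith) hq
  refine (PMF.toOuterMeasure_mono _ hsub).trans ((MeasureTheory.measure_union_le _ _).trans ?_)
  refine (add_le_add (key _ rfl) (key _ (neg_sq _))).trans_eq ?_
  rw [← ENNReal.ofReal_add (Real.exp_pos _).le (Real.exp_pos _).le, two_mul]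

end Pull

/-! ### Unbiasedness of the loss estimate. -/

section Unbiased
variable {n : ℕ} {m : Fin n → ℕ}

/-- Once the second Π is dropped, the estimate is affine in g', so averaging replaces g' by its
mean. Symmetry then treats g in the same way. -/
theorem expect_sampleValue {u : Fin n → Profile m → ℝ} (est : GradientEstimator u)
    (η : Fin n → ℝ) (τ : ℝ) (x : MixedProfile m) (g : ∀ k, Fin (m k) → ℝ) :
    expect (est.law x) (sampleValue η τ x g) = sampleValue η τ x g (gradient u x) := by
  set A : ∀ k, Fin (m k) → ℝ := fun k l => η k * tangentProj (addEntropy τ x g k) l with hA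
  set e : ∀ k, Fin (m k) → ℝ := fun k l => τ * (Real.log ((x k).1 l) + 1) with he
  have hval : sampleValue η τ x g = fun g' => ∑ k, ∑ l, A k l * (g' k l - e k l) := by
    funext g'
    refine Finset.sum_congr rfl fun k _ => ?_
    rw [sum_mul_tangentProj_tangentProj, Finset.mul_sum]
    exact Finset.sum_congr rfl fun l _ => by simp only [hA, he, addEntropy]; ring
  have hg : ∀ g' ∈ (est.law x).support, ∀ k l, |g' k l| ≤ 1 := fun g' hg' k l => by
    obtain ⟨h1, h2⟩ := est.mem_unit x g' hg' k l
    rw [abs_of_nonneg h1]; exact h2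
  have hterm : ∀ g' ∈ (est.law x).support, ∀ k l,
      |A k l * (g' k l - e k l)| ≤ |A k l| * (1 + |e k l|) := fun g' hg' k l => by
    rw [abs_mul]
    refine mul_le_mul_of_nonneg_left ?_ (abs_nonneg _)
    exact (abs_sub _ _).trans (by linarith [hg g' hg' k l])
  rw [hval, expect_finset_sum (B := fun k => ∑ l, |A k l| * (1 + |e k l|)) _
    fun k _ g' hg' => (Finset.abs_sum_le_sum_abs _ _).trans
      (Finset.sum_le_sum fun l _ => hterm g' hg' k l)]
  refine Finset.sum_congr rfl fun k _ => ?_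
  rw [expect_finset_sum (B := fun l => |A k l| * (1 + |e k l|)) _
    fun l _ g' hg' => hterm g' hg' k l]
  refine Finset.sum_congr rfl fun l _ => ?_
  rw [expect_mul_left, expect_sub (B := 1) (C := |e k l|) (fun g' hg' => hg g' hg' k l)
    (fun _ _ => le_rfl), expect_const, expect, est.unbiased]

theorem sampleValue_comm (η : Fin n → ℝ) (τ : ℝ) (x : MixedProfile m)
    (g g' : ∀ k, Fin (m k) → ℝ) : sampleValue η τ x g g' = sampleValue η τ x g' g := by
  simp only [sampleValue, mul_comm]

theorem sampleValue_gradient (u : Fin n → Profile m → ℝ) (η : Fin n → ℝ) (τ : ℝ)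
    (x : MixedProfile m) :
    sampleValue η τ x (gradient u x) (gradient u x) = loss u η τ x := by
  simp only [sampleValue, loss, sq]

theorem expect_neg_lossSample (hn : 0 < n) {u : Fin n → Profile m → ℝ}
    (est : GradientEstimator u) {p : ℝ} (hp : p ∈ Set.Ioo (0 : ℝ) 1) {τ : ℝ}
    (hτ : τ = 1 / Real.log (1 / p)) {η : Fin n → ℝ} (hη : ∀ k, η k = 2 / Lhat m p)
    {x : MixedProfile m} (hx : IsInterior p x) :
    expect ((lossSample est η τ x).map fun y => -y) id = -loss u η τ x := by
  have hB : ∀ g ∈ (est.law x).support, ∀ g' ∈ (est.law x).support,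
      |sampleValue η τ x g g'| ≤ rangeBound m p / 2 := fun g hg g' hg' =>
    abs_sampleValue_le hp hn hx hτ hη (est.mem_unit x g hg) (est.mem_unit x g' hg')
  have hB' : ∀ y ∈ (lossSample est η τ x).support, |y| ≤ rangeBound m p / 2 := by
    intro y hy
    obtain ⟨g, g', hg, hg', rfl⟩ := mem_support_lossSample hy
    exact abs_sampleValue_le hp hn hx hτ hη hg hg'
  have hneg : expect (lossSample est η τ x) (fun y => -y) = -expect (lossSample est η τ x) id := by
    rw [← neg_one_mul, ← expect_mul_left]
    simp
  rw [expect_map (B := rangeBound m p / 2) (fun y hy => by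
    simpa using hB' y hy)]
  simp only [id_eq]
  rw [hneg, lossSample, expect_bind (B := rangeBound m p / 2)]
  · congr 1
    have : expect (est.law x) (fun g => expect ((est.law x).map (sampleValue η τ x g)) id)
        = loss u η τ x := by
      rw [expect_congr (g := sampleValue η τ x (gradient u x)), expect_sampleValue,
        sampleValue_gradient]
      intro g hg
      rw [expect_map (f := id) (g := sampleValue η τ x g) (B := rangeBound m p / 2)
        fun g' hg' => hB g hg g' hg']
      simp only [id_eq]
      rw [expect_sampleValue, sampleValue_comm]
    exact this
  · intro g hg y hy
    rw [PMF.mem_support_map_iff] at hy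
    obtain ⟨g', hg', rfl⟩ := hy
    exact hB g hg g' hg'

end Unbiased

/-! ### Counting dyadic cubes by volume. -/

section Counting
open MeasureTheory
variable {d : ℕ}

/-- The half-open dyadic cube of edge length `2^{-j}` with lower corner `2^{-j} C`. -/
def openCube (j : ℕ) (C : Fin d → ℕ) : Set (Fin d → ℝ) :=
  Set.univ.pi fun i => Set.Ico ((C i : ℝ) / 2 ^ j) (((C i : ℝ) + 1) / 2 ^ j)

theorem volume_openCube (j : ℕ) (C : Fin d → ℕ) :
    volume (openCube j C) = ENNReal.ofReal ((1 / 2 ^ j) ^ d) := by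
  rw [openCube, Real.volume_pi_Ico, ENNReal.ofReal_pow (by positivity)]
  simp [← sub_div]

theorem pairwise_disjoint_openCube (j : ℕ) :
    Pairwise (Function.onFun Disjoint (openCube (d := d) j)) := by
  intro C D hCD
  rw [Function.onFun, Set.disjoint_left]
  intro z hz hz'
  refine hCD (funext fun i => ?_)
  have h1 := hz i (Set.mem_univ i)
  have h2 := hz' i (Set.mem_univ i)
  have hj : (0 : ℝ) < 2 ^ j := by positivity
  simp only [Set.mem_Ico, div_le_iff₀ hj, lt_div_iff₀ hj] at h1 h2
  have h3 : (C i : ℝ) < D i + 1 := by linarith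
  have h4 : (D i : ℝ) < C i + 1 := by linarith
  norm_cast at h3 h4
  omega

/-- The number of dyadic cubes of edge length `2^{-j}` in a union of `N` balls of radius `R` in
the sup norm is at most `N (2^{j + 1} R)^d`. -/
theorem card_cubes_le {j : ℕ} {S : Finset (Fin d → ℕ)} (hS : ∀ C ∈ S, ∀ q, C q < 2 ^ j)
    {X : Set (Arm d)} (hX : X.Finite) {R : ℝ} (hR : 0 ≤ R)
    (hcov : ∀ C ∈ S, ∀ z ∈ cube j C, ∃ z₁ ∈ X, dist z z₁ ≤ R) :
    (S.card : ℝ) ≤ X.ncard * (2 * R * 2 ^ j) ^ d := by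
  -- The half-open cubes are disjoint, so their volumes add up; sup-norm balls have volume (2R)^d.
  have hsub : (⋃ C ∈ S, openCube j C) ⊆ ⋃ z₁ ∈ hX.toFinset, Metric.closedBall z₁.1 R := by
    intro z hz
    simp only [Set.mem_iUnion] at hz
    obtain ⟨C, hC, hz⟩ := hz
    have hj : (0 : ℝ) < 2 ^ j := by positivity
    have hz' : ∀ i, (C i : ℝ) / 2 ^ j ≤ z i ∧ z i < ((C i : ℝ) + 1) / 2 ^ j :=
      fun i => hz i (Set.mem_univ i)
    have hmem : z ∈ Set.Icc (0 : Fin d → ℝ) 1 := by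
      refine ⟨fun i => le_trans (by simp only [Pi.zero_apply]; positivity) (hz' i).1,
        fun i => (hz' i).2.le.trans ?_⟩
      rw [div_le_iff₀ hj, Pi.one_apply, one_mul]
      exact_mod_cast hS C hC i
    obtain ⟨z₁, hz₁, hd⟩ := hcov C hC ⟨z, hmem⟩ fun i => ⟨(hz' i).1, (hz' i).2.le⟩
    simp only [Set.mem_iUnion, Set.Finite.mem_toFinset]
    exact ⟨z₁, hz₁, hd⟩
  have hvol := measure_mono (μ := volume) hsub
  rw [measure_biUnion_finset (fun C _ D _ h => pairwise_disjoint_openCube j h)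
    fun C _ => MeasurableSet.univ_pi fun i => measurableSet_Ico] at hvol
  have h2 := hvol.trans (measure_biUnion_finset_le _ _)
  simp only [volume_openCube, Real.volume_pi_closedBall _ hR, Finset.sum_const, nsmul_eq_mul,
    Fintype.card_fin] at h2
  rw [← ENNReal.ofReal_natCast, ← ENNReal.ofReal_natCast, ← ENNReal.ofReal_mul (by positivity),
    ← ENNReal.ofReal_mul (by positivity), ENNReal.ofReal_le_ofReal_iff (by positivity),
    ← Set.ncard_eq_toFinset_card _ hX] at h2
  have hj : (0 : ℝ) < (2 ^ j) ^ d := by positivity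
  calc (S.card : ℝ) = S.card * (1 / 2 ^ j) ^ d * (2 ^ j) ^ d := by
        rw [mul_assoc, ← mul_pow]; simp
    _ ≤ X.ncard * (2 * R) ^ d * (2 ^ j) ^ d := mul_le_mul_of_nonneg_right h2 hj.le
    _ = _ := by rw [mul_assoc, ← mul_pow]

theorem card_cubes_le_pow {j : ℕ} {S : Finset (Fin d → ℕ)} (hS : ∀ C ∈ S, ∀ q, C q < 2 ^ j) :
    S.card ≤ (2 ^ j) ^ d := by
  have : S ⊆ Fintype.piFinset fun _ : Fin d => Finset.range (2 ^ j) := fun C hC => by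
    simpa using hS C hC
  simpa using Finset.card_le_card this

end Counting

/-! ### Sublevel sets under quadratic growth. -/

section Growth
variable {d : ℕ} {F : Arm d → ℝ} {σ r : ℝ}

/-- If σr² > 1, the growth condition applies to every point, as F varies by at most 1. With the
Lipschitz bound, σ dist² ≤ dist, so balls of radius 1/σ about the optima cover the cube. Their
volume and the smallness condition give r²σ^{3/2} ≤ 1, hence σ ≤ 1; since also 2r²√σ ≤ 1, this
contradicts σr² > 1. -/
theorem sigma_mul_sq_le_one (hd : 0 < d) (hσ : 0 < σ) (hr : 0 < r)
    (hlip : ∀ z z', |F z - F z'| ≤ dist z z') (hfin : (globalOptima F).Finite)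
    {z₀ : Arm d} (hz₀ : z₀ ∈ globalOptima F) (hgrowth : LocalQuadraticGrowth F σ r)
    (hsmall : (globalOptima F).ncard * (2 * r ^ 2 * √σ) ^ d ≤ 1) : σ * r ^ 2 ≤ 1 := by
  by_contra! hlt
  have hN : 1 ≤ ((globalOptima F).ncard : ℝ) := by
    exact_mod_cast (Set.ncard_pos hfin).2 ⟨z₀, hz₀⟩
  have hdist : ∀ z : Arm d, dist z z₀ ≤ 1 := fun z => by
    rw [Subtype.dist_eq, dist_pi_le_iff zero_le_one]
    intro i
    rw [Real.dist_eq, abs_le]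
    have h1 := z.2.1 i; have h2 := z.2.2 i; have h3 := z₀.2.1 i; have h4 := z₀.2.2 i
    simp only [Pi.zero_apply, Pi.one_apply] at h1 h2 h3 h4
    constructor <;> linarith
  have hcov : ∀ z : Arm d, ∃ z₁ ∈ globalOptima F, dist z z₁ ≤ 1 / σ := by
    intro z
    obtain ⟨z₁, hz₁, h⟩ := hgrowth z ⟨z₀, hz₀, by
      have := (abs_le.1 (hlip z z₀)).2
      linarith [hdist z]⟩
    refine ⟨z₁, hz₁, ?_⟩
    have h1 := (abs_le.1 (hlip z z₁)).2
    have h2 : σ * dist z z₁ ^ 2 ≤ dist z z₁ := by linarith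
    rw [le_div_iff₀ hσ]
    by_contra! h3
    have h4 : 0 < dist z z₁ := by
      by_contra! h5
      have := mul_nonpos_of_nonpos_of_nonneg h5 hσ.le
      linarith
    nlinarith
  have hcount := card_cubes_le (j := 0) (S := {fun _ : Fin d => 0}) (by simp) hfin
    (R := 1 / σ) (by positivity) (fun _ _ z _ => hcov z)
  simp only [Finset.card_singleton, Nat.cast_one, pow_zero, mul_one] at hcount
  have hs : 0 < √σ := Real.sqrt_pos.2 hσ
  have hss : √σ ^ 2 = σ := Real.sq_sqrt hσ.le
  have h1 : (2 * r ^ 2 * √σ) ^ d ≤ (2 * (1 / σ)) ^ d :=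
    le_of_mul_le_mul_left (hsmall.trans hcount) (by linarith)
  have h2 := le_of_pow_le_pow_left₀ hd.ne' (by positivity) h1
  have h3 : (2 * r ^ 2 * √σ) ^ d ≤ 1 :=
    le_trans (le_mul_of_one_le_left (by positivity) hN) hsmall
  have h4 : 2 * r ^ 2 * √σ ≤ 1 := by
    by_contra! h
    exact absurd h3 (not_le.2 (one_lt_pow₀ h hd.ne'))
  have h5 : r ^ 2 * √σ * σ ≤ 1 := by
    have h6 := mul_le_mul_of_nonneg_right h2 hσ.le
    have : 2 * (1 / σ) * σ = 2 := by field_simp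
    linarith
  have h7 : √σ ≤ 1 := by nlinarith
  nlinarith

/-- Number of dyadic cubes of edge length `2^{-j}` that lie in a sublevel set of height
`K 2^{-j}`. -/
theorem card_sublevel_cubes_le (hσ : 0 < σ) (hr : 0 < r) (hfin : (globalOptima F).Finite)
    (hpos : ∀ z, 0 ≤ F z) {z₀ : Arm d} (hz₀ : F z₀ = 0) (hgrowth : LocalQuadraticGrowth F σ r)
    (hsmall : (globalOptima F).ncard * (2 * r ^ 2 * √σ) ^ d ≤ 1) (hσr : σ * r ^ 2 ≤ 1)
    {K : ℝ} (hK : 0 < K) {j : ℕ} {S : Finset (Fin d → ℕ)} (hS : ∀ C ∈ S, ∀ q, C q < 2 ^ j)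
    (hF : ∀ C ∈ S, ∀ z ∈ cube j C, F z ≤ K / 2 ^ j) :
    (S.card : ℝ) ≤ (√K / (r ^ 2 * σ) * √2 ^ j) ^ d := by
  have hopt : ∀ z₁ ∈ globalOptima F, F z₁ = 0 := fun z₁ h => le_antisymm (hz₀ ▸ h z₀) (hpos z₁)
  have hz₀' : z₀ ∈ globalOptima F := fun z => hz₀ ▸ hpos z
  have hj : (0 : ℝ) < 2 ^ j := by positivity
  have hs : 0 < √σ := Real.sqrt_pos.2 hσ
  have hk : 0 < √K := Real.sqrt_pos.2 hK
  have h2 : 0 < √2 ^ j := by positivity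
  have hss : √σ ^ 2 = σ := Real.sq_sqrt hσ.le
  have hkk : √K ^ 2 = K := Real.sq_sqrt hK.le
  have h22 : (2 : ℝ) ^ j = (√2 ^ j) ^ 2 := by
    rw [← pow_mul, mul_comm, pow_mul, Real.sq_sqrt zero_le_two]
  -- In the growth regime the sublevel set lies within √(K 2^{-j}/σ) of the optima, and the
  -- smallness condition trades their number for the factor 1/(2r²√σ)^d.
  by_cases hcase : K / 2 ^ j ≤ σ * r ^ 2
  · have hcov : ∀ C ∈ S, ∀ z ∈ cube j C, ∃ z₁ ∈ globalOptima F,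
        dist z z₁ ≤ √K / (√σ * √2 ^ j) := by
      intro C hC z hz
      have hFz := hF C hC z hz
      obtain ⟨z₁, hz₁, h⟩ := hgrowth z ⟨z₀, hz₀', by rw [hz₀]; linarith⟩
      refine ⟨z₁, hz₁, ?_⟩
      rw [hopt z₁ hz₁, zero_add] at h
      refine le_of_sq_le_sq ?_ (by positivity)
      rw [div_pow, mul_pow, hkk, hss, ← h22, mul_comm σ, ← div_div, le_div_iff₀ hσ]
      linarith
    have hcount := card_cubes_le hS hfin (by positivity) hcov
    have heq : 2 * (√K / (√σ * √2 ^ j)) * 2 ^ j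
        = (2 * r ^ 2 * √σ) * (√K / (r ^ 2 * σ) * √2 ^ j) := by
      rw [h22]
      rw [show r ^ 2 * σ = r ^ 2 * √σ ^ 2 by rw [hss]]
      field_simp
    rw [heq, mul_pow, ← mul_assoc] at hcount
    exact hcount.trans (mul_le_of_le_one_left (by positivity) hsmall)
  -- At coarse levels the trivial count 2^{jd} is enough, because 2^j (r²σ)² ≤ K.
  · push Not at hcase
    have h1 : (S.card : ℝ) ≤ (2 ^ j) ^ d := by exact_mod_cast card_cubes_le_pow hS
    refine h1.trans (pow_le_pow_left₀ hj.le ?_ d)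
    rw [h22, sq]
    refine mul_le_mul_of_nonneg_right ?_ h2.le
    refine le_of_sq_le_sq ?_ (by positivity)
    rw [lt_div_iff₀ hj] at hcase
    rw [← h22, div_pow, hkk, le_div_iff₀ (by positivity)]
    calc 2 ^ j * (r ^ 2 * σ) ^ 2 = (σ * r ^ 2 * 2 ^ j) * (σ * r ^ 2) := by ring
      _ ≤ K * 1 := mul_le_mul hcase.le hσr (by positivity) hK.le
      _ = K := mul_one K

end Growth

/-! ### Dyadic cubes and their subdivision. -/

section Cubes
variable {d : ℕ}

theorem dist_le_of_mem_cube {j : ℕ} {C : Fin d → ℕ} {z z' : Arm d} (hz : z ∈ cube j C)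
    (hz' : z' ∈ cube j C) : dist z z' ≤ (1 / 2 : ℝ) ^ j := by
  rw [Subtype.dist_eq, dist_pi_le_iff (by positivity)]
  intro i
  have h1 := hz i
  have h2 := hz' i
  rw [Real.dist_eq, abs_le]
  have h3 : ((C i : ℝ) + 1) / 2 ^ j = C i / 2 ^ j + (1 / 2) ^ j := by
    rw [one_div_pow, add_div]
  constructor <;> linarith [h1.1, h1.2, h2.1, h2.2]

theorem mem_children {C C' : Fin d → ℕ} :
    C' ∈ children C ↔ ∀ i, C' i = 2 * C i ∨ C' i = 2 * C i + 1 := by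
  simp [children]

theorem nodup_children (C : Fin d → ℕ) : (children C).Nodup := Finset.nodup_toList _

theorem disjoint_children {C D : Fin d → ℕ} (h : C ≠ D) :
    List.Disjoint (children C) (children D) := by
  intro E hC hD
  rw [mem_children] at hC hD
  refine h (funext fun i => ?_)
  have := hC i
  have := hD i
  omega

theorem cube_subset_of_mem_children {j : ℕ} {C C' : Fin d → ℕ} (h : C' ∈ children C) :
    cube (j + 1) C' ⊆ cube j C := by
  rw [mem_children] at h
  intro z hz i
  obtain ⟨h1, h2⟩ := hz i
  have hj : (0 : ℝ) < 2 ^ j := by positivity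
  rw [pow_succ, div_le_iff₀ (by positivity)] at h1
  rw [pow_succ, le_div_iff₀ (by positivity)] at h2
  rw [div_le_iff₀ hj, le_div_iff₀ hj]
  rcases h i with h | h <;> rw [h] at h1 h2 <;> push_cast at h1 h2 <;> constructor <;> linarith

theorem exists_mem_children {j : ℕ} {C : Fin d → ℕ} {z : Arm d} (hz : z ∈ cube j C) :
    ∃ C' ∈ children C, z ∈ cube (j + 1) C' := by
  have hj : (0 : ℝ) < 2 ^ j := by positivity
  have : ∀ i, ∃ c : ℕ, (c = 2 * C i ∨ c = 2 * C i + 1) ∧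
      (c : ℝ) / 2 ^ (j + 1) ≤ z.1 i ∧ z.1 i ≤ ((c : ℝ) + 1) / 2 ^ (j + 1) := by
    intro i
    obtain ⟨h1, h2⟩ := hz i
    rw [div_le_iff₀ hj] at h1
    rw [le_div_iff₀ hj] at h2
    have hj' : (0 : ℝ) < 2 ^ j * 2 := by positivity
    simp only [pow_succ, div_le_iff₀ hj', le_div_iff₀ hj']
    rcases le_total (z.1 i * (2 ^ j * 2)) (2 * C i + 1) with h | h
    · exact ⟨2 * C i, Or.inl rfl, by push_cast; linarith, by push_cast; linarith⟩
    · exact ⟨2 * C i + 1, Or.inr rfl, by push_cast; linarith, by push_cast; linarith⟩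
  choose C' h1 h2 using this
  exact ⟨C', mem_children.2 h1, h2⟩

end Cubes

/-! ### The run of D-BLiN on the event of accurate averages. -/

section Algorithm
variable {d : ℕ} {F : Arm d → ℝ} {q : ℝ} {z₀ : Arm d}

/-- The average reward of a cube predicts `-F` on the cube up to `(1 + q) 2^{-j}`. -/
def Accurate (F : Arm d → ℝ) (q : ℝ) (j : ℕ) (e : (Fin d → ℕ) × List (Arm d × ℝ)) : Prop :=
  ∀ z ∈ cube j e.1, |meanReward e.2 + F z| < (1 + q) * (1 / 2 : ℝ) ^ j

/-- What holds of the active cubes of level `j` as long as all average rewards are accurate. -/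
structure Active (F : Arm d → ℝ) (q : ℝ) (z₀ : Arm d) (j : ℕ) (A : List (Fin d → ℕ)) : Prop where
  nodup : A.Nodup
  index_lt : ∀ C ∈ A, ∀ i, C i < 2 ^ j
  exists_mem : ∃ C ∈ A, z₀ ∈ cube j C
  value_le : ∀ C ∈ A, ∀ z ∈ cube j C, F z ≤ 8 * (1 + q) * (1 / 2 : ℝ) ^ j

theorem survivors_sublist (thr : ℝ) (b : List ((Fin d → ℕ) × List (Arm d × ℝ))) :
    (survivors thr b).Sublist (b.map Prod.fst) :=
  List.filter_sublist.map _

theorem mem_survivors {thr : ℝ} {b : List ((Fin d → ℕ) × List (Arm d × ℝ))} {C : Fin d → ℕ} :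
    C ∈ survivors thr b ↔
      ∃ e ∈ b, e.1 = C ∧ ∀ e' ∈ b, meanReward e'.2 - meanReward e.2 < thr := by
  simp only [survivors, List.mem_map, List.mem_filter, decide_eq_true_eq]
  constructor
  · rintro ⟨e, ⟨h1, h2⟩, h3⟩; exact ⟨e, h1, h3, h2⟩
  · rintro ⟨e, h1, h2, h3⟩; exact ⟨e, ⟨h1, h3⟩, h2⟩

theorem cube_nonempty {j : ℕ} {C : Fin d → ℕ} (hC : ∀ i, C i < 2 ^ j) : (cube j C).Nonempty := by
  have hj : (0 : ℝ) < 2 ^ j := by positivity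
  refine ⟨⟨fun i => C i / 2 ^ j, fun i => by simp only [Pi.zero_apply]; positivity, fun i => ?_⟩,
    fun i => ⟨le_rfl,
      div_le_div_of_nonneg_right (le_add_of_nonneg_right zero_le_one) hj.le⟩⟩
  simp only [Pi.one_apply]
  rw [div_le_one hj]
  exact_mod_cast (hC i).le

/-- No average beats that of the optimal cube by 2(1 + q)2^{-j}, since two accuracy errors are all
that separates them from F ≥ 0 = F z₀. A survivor is within the threshold of the optimal cube, so F
≤ (1 + 2 + 1)(1 + q)2^{-j} on it, which is the bound of level j + 1. -/
theorem Active.next (hpos : ∀ z, 0 ≤ F z) (hz₀ : F z₀ = 0) {j : ℕ} {A : List (Fin d → ℕ)}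
    (hA : Active F q z₀ j A) {b : List ((Fin d → ℕ) × List (Arm d × ℝ))}
    (hb : b.map Prod.fst = A) (hacc : ∀ e ∈ b, Accurate F q j e) :
    Active F q z₀ (j + 1)
      ((survivors (2 * (1 + q) * (1 / 2 : ℝ) ^ j) b).flatMap children) := by
  have hsub := survivors_sublist (2 * (1 + q) * (1 / 2 : ℝ) ^ j) b
  rw [hb] at hsub
  obtain ⟨C₀, hC₀, hzC₀⟩ := hA.exists_mem
  obtain ⟨e₀, he₀, rfl⟩ := List.mem_map.1 (hb.symm ▸ hC₀ : C₀ ∈ b.map Prod.fst)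
  have hacc₀ := abs_lt.1 (hacc e₀ he₀ z₀ hzC₀)
  refine ⟨?_, ?_, ?_, ?_⟩
  · rw [List.nodup_flatMap]
    exact ⟨fun C _ => nodup_children C, (hsub.nodup hA.nodup).imp disjoint_children⟩
  · intro C' hC' i
    obtain ⟨C, hC, hCC'⟩ := List.mem_flatMap.1 hC'
    have h1 := hA.index_lt C (hsub.subset hC) i
    have h2 := mem_children.1 hCC' i
    rw [pow_succ]
    omega
  · obtain ⟨C', hC', hz'⟩ := exists_mem_children hzC₀
    refine ⟨C', List.mem_flatMap.2 ⟨e₀.1, mem_survivors.2 ⟨e₀, he₀, rfl, fun e' he' => ?_⟩, hC'⟩, hz'⟩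
    obtain ⟨z', hz''⟩ := cube_nonempty (hA.index_lt e'.1 (hb ▸ List.mem_map_of_mem he'))
    have := abs_lt.1 (hacc e' he' z' hz'')
    linarith [hpos z', this.2, hacc₀.1]
  · intro C' hC' z hz
    obtain ⟨C, hC, hCC'⟩ := List.mem_flatMap.1 hC'
    obtain ⟨e, he, rfl, hmax⟩ := mem_survivors.1 hC
    have h1 := abs_lt.1 (hacc e he z (cube_subset_of_mem_children hCC' hz))
    have h2 := hmax e₀ he₀
    rw [pow_succ]
    linarith [h1.2, hacc₀.1]

theorem active_zero (hq : 0 ≤ q) (hlip : ∀ z z', |F z - F z'| ≤ dist z z') (hz₀ : F z₀ = 0) :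
    Active F q z₀ 0 [fun _ => 0] := by
  have hmem : ∀ z : Arm d, z ∈ cube 0 (fun _ : Fin d => 0) := fun z i => by
    simpa using ⟨z.2.1 i, z.2.2 i⟩
  refine ⟨List.nodup_singleton _, by simp, ⟨_, List.mem_singleton_self _, hmem z₀⟩, ?_⟩
  intro C hC z hz
  rw [List.mem_singleton.1 hC] at hz
  have h1 := dist_le_of_mem_cube hz (hmem z₀)
  have h2 := (abs_le.1 (hlip z z₀)).2
  rw [pow_zero] at h1 ⊢
  linarith

theorem abs_sum_add_le {zs : List (Arm d)} {v w : ℝ} (h : ∀ z ∈ zs, |F z - v| ≤ w) :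
    |(zs.map fun z => -F z).sum + zs.length * v| ≤ zs.length * w := by
  induction zs with
  | nil => simp
  | cons z zs ih =>
    have h1 := abs_le.1 (h z List.mem_cons_self)
    have h2 := abs_le.1 (ih fun z' hz' => h z' (List.mem_cons_of_mem _ hz'))
    simp only [List.map_cons, List.sum_cons, List.length_cons, Nat.cast_succ]
    rw [abs_le]
    constructor <;> linarith [h1.1, h1.2, h2.1, h2.2]

variable {reward : Arm d → PMF ℝ}

/-- The error (1 + q)2^{-j} consists of the oscillation 2^{-j} of F on the cube and the sampling
error q 2^{-j}. -/
theorem toOuterMeasure_pullAll_not_accurate_le (hlip : ∀ z z', |F z - F z'| ≤ dist z z')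
    {a c : ℝ} (hc : 0 < c) (hr : ∀ z, ∀ y ∈ (reward z).support, y ∈ Set.Icc a (a + c))
    (hmean : ∀ z, expect (reward z) id = -F z) (hq : 0 ≤ q) {j : ℕ} {C : Fin d → ℕ}
    {zs : List (Arm d)} (hne : zs ≠ []) (hzs : ∀ z ∈ zs, z ∈ cube j C) :
    (pullAll reward zs).toOuterMeasure {o | ¬ Accurate F q j (C, o)}
      ≤ ENNReal.ofReal (2 * Real.exp (-2 * zs.length * (q * (1 / 2 : ℝ) ^ j) ^ 2 / c ^ 2)) := by
  refine le_trans (MeasureTheory.measure_mono ?_) (toOuterMeasure_pullAll_le hc hr hne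
    (by positivity : 0 ≤ q * (1 / 2 : ℝ) ^ j))
  intro o ho hlt
  refine ho fun z hz => ?_
  simp only [hmean] at hlt
  have hN : 0 < (zs.length : ℝ) := by exact_mod_cast List.length_pos_iff.2 hne
  have h1 := abs_sum_add_le (F := F) (v := F z) (w := (1 / 2 : ℝ) ^ j) (zs := zs) fun z' hz' =>
    (hlip z' z).trans (dist_le_of_mem_cube (hzs z' hz') hz)
  have h2 : |(zs.map fun z => -F z).sum / zs.length + F z| ≤ (1 / 2 : ℝ) ^ j := by
    have : (zs.map fun z => -F z).sum / zs.length + F z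
        = ((zs.map fun z => -F z).sum + zs.length * F z) / zs.length := by field_simp
    rw [this, abs_div, abs_of_pos hN, div_le_iff₀ hN, mul_comm ((1 / 2 : ℝ) ^ j)]
    exact h1
  rw [abs_lt] at hlt ⊢
  rw [abs_le] at h2
  constructor <;> linarith [hlt.1, hlt.2, h2.1, h2.2]

/-- The record of a batch lists the active cubes with the selected arms. -/
def IsRecord (pick : (Fin d → ℕ) → ℕ → Arm d) (N : ℕ) (A : List (Fin d → ℕ))
    (b : List ((Fin d → ℕ) × List (Arm d × ℝ))) : Prop :=
  b.map Prod.fst = A ∧ ∀ e ∈ b, e.2.map Prod.fst = (List.range N).map (pick e.1)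

theorem isRecord_of_mem_support {pick : (Fin d → ℕ) → ℕ → Arm d} {N : ℕ} {A : List (Fin d → ℕ)}
    {b : List ((Fin d → ℕ) × List (Arm d × ℝ))} (hb : b ∈ (playBatch reward pick N A).support) :
    IsRecord pick N A b := by
  induction A generalizing b with
  | nil =>
    rw [playBatch, PMF.mem_support_pure_iff] at hb
    subst hb
    exact ⟨rfl, by simp⟩
  | cons C A ih =>
    simp only [playBatch, PMF.mem_support_bind_iff, PMF.mem_support_map_iff] at hb
    obtain ⟨o, ho, b', hb', rfl⟩ := hb
    obtain ⟨h1, h2⟩ := ih hb'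
    refine ⟨by simp [h1], fun e he => ?_⟩
    rcases List.mem_cons.1 he with rfl | he
    · exact map_fst_of_mem_support_pullAll ho
    · exact h2 e he

theorem toOuterMeasure_playBatch_le {pick : (Fin d → ℕ) → ℕ → Arm d} {N j : ℕ} {β : ℝ≥0∞}
    {A : List (Fin d → ℕ)}
    (h : ∀ C ∈ A, (pullAll reward ((List.range N).map (pick C))).toOuterMeasure
      {o | ¬ Accurate F q j (C, o)} ≤ β) :
    (playBatch reward pick N A).toOuterMeasure {b | ∀ e ∈ b, Accurate F q j e}ᶜ
      ≤ A.length * β := by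
  induction A with
  | nil => simp [playBatch, PMF.toOuterMeasure_pure_apply]
  | cons C A ih =>
    rw [playBatch]
    refine (pmf_toOuterMeasure_bind_le (G := {o | Accurate F q j (C, o)})
      (h C List.mem_cons_self) (b := A.length * β) fun o _ ho => ?_).trans_eq ?_
    · rw [PMF.toOuterMeasure_map_apply]
      refine le_trans (MeasureTheory.measure_mono ?_)
        (ih fun C' hC' => h C' (List.mem_cons_of_mem _ hC'))
      intro b hb hb'
      refine hb fun e he => ?_
      rcases List.mem_cons.1 he with rfl | he
      · exact ho
      · exact hb' e he
    · rw [List.length_cons, Nat.cast_succ, add_mul, one_mul, add_comm]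

/-- Accumulated regret of a run. -/
def regret (F : Arm d → ℝ) (h : List (Arm d × ℝ)) : ℝ := (h.map fun o => F o.1).sum

theorem regret_append (h h' : List (Arm d × ℝ)) :
    regret F (h ++ h') = regret F h + regret F h' := by
  simp [regret]

theorem regret_le {h : List (Arm d × ℝ)} {v : ℝ} (hv : ∀ o ∈ h, F o.1 ≤ v) :
    regret F h ≤ h.length * v := by
  have := List.sum_le_card_nsmul (h.map fun o => F o.1) v fun x hx => by
    obtain ⟨o, ho, rfl⟩ := List.mem_map.1 hx
    exact hv o ho
  simpa [regret] using this

theorem IsRecord.length_flatMap {pick : (Fin d → ℕ) → ℕ → Arm d} {N : ℕ} {A : List (Fin d → ℕ)}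
    {b : List ((Fin d → ℕ) × List (Arm d × ℝ))} (hb : IsRecord pick N A b) :
    (b.flatMap Prod.snd).length = A.length * N := by
  have h : ∀ e ∈ b, e.2.length = N := fun e he => by
    simpa using congrArg List.length (hb.2 e he)
  rw [List.length_flatMap, ← hb.1, List.length_map, List.map_congr_left h]
  simp

theorem IsRecord.regret_le {pick : (Fin d → ℕ) → ℕ → Arm d} {N : ℕ} {A : List (Fin d → ℕ)}
    {b : List ((Fin d → ℕ) × List (Arm d × ℝ))} (hb : IsRecord pick N A b) {v : ℝ}
    (hv : ∀ C ∈ A, ∀ i, F (pick C i) ≤ v) :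
    regret F (b.flatMap Prod.snd) ≤ (A.length * N : ℕ) * v := by
  rw [← hb.length_flatMap]
  refine NashBandit.regret_le fun o ho => ?_
  obtain ⟨e, he, ho⟩ := List.mem_flatMap.1 ho
  have h1 : o.1 ∈ e.2.map Prod.fst := List.mem_map_of_mem ho
  rw [hb.2 e he] at h1
  obtain ⟨i, -, hi⟩ := List.mem_map.1 h1
  rw [← hi]
  exact hv e.1 (hb.1 ▸ List.mem_map_of_mem he) i

/-- Induction over batches. The regret of k pulls at level j is charged to a level budget W j plus κ
per pull, so that fine levels can be charged to κ alone. Each cube tested fails with probability at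
most β and costs at least one pull, so the remaining pulls bound the number of tests. -/
theorem toOuterMeasure_batches_le (hpos : ∀ z, 0 ≤ F z) (hz₀ : F z₀ = 0)
    (hlip : ∀ z z', |F z - F z'| ≤ dist z z')
    {a c : ℝ} (hc : 0 < c) (hr : ∀ z, ∀ y ∈ (reward z).support, y ∈ Set.Icc a (a + c))
    (hmean : ∀ z, expect (reward z) id = -F z) (hq : 0 ≤ q)
    (sel : SelectionRule d) {T : ℕ} {pulls : ℕ → ℕ} (hpulls : ∀ j, 0 < pulls j) {β : ℝ≥0∞}
    (hβ : ∀ j, ENNReal.ofReal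
      (2 * Real.exp (-2 * pulls j * (q * (1 / 2 : ℝ) ^ j) ^ 2 / c ^ 2)) ≤ β)
    {W : ℕ → ℝ} {Wtot κ : ℝ}
    (hW : ∀ j A, Active F q z₀ j A → ∀ k ≤ A.length * pulls j,
      (k : ℝ) * (8 * (1 + q) * (1 / 2 : ℝ) ^ j) ≤ W j + k * κ)
    (hWtot : ∀ j, ∑ i ∈ Finset.range j, W i ≤ Wtot)
    (fuel j : ℕ) (A : List (Fin d → ℕ)) (h : List (Arm d × ℝ)) (hA : Active F q z₀ j A)
    (hh : h.length < T) (hfuel : T + 1 ≤ fuel + h.length)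
    (hreg : regret F h ≤ ∑ i ∈ Finset.range j, W i + h.length * κ) :
    (batches reward sel T pulls (fun j => 2 * (1 + q) * (1 / 2 : ℝ) ^ j) fuel j A h).toOuterMeasure
      {o | ¬ (o.length = T ∧ regret F o ≤ Wtot + T * κ)} ≤ (T - h.length : ℕ) * β := by
  induction fuel generalizing j A h with
  -- Out of reach: every batch uses a pull, so fuel and pulls together stay above T.
  | zero => omega
  | succ fuel ih =>
    rw [batches]
    split_ifs with hT
    -- The final clean-up eliminates nothing, so its regret bound holds surely.
    · refine le_of_eq_of_le ?_ zero_le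
      rw [PMF.toOuterMeasure_map_apply, PMF.toOuterMeasure_apply_eq_zero_iff, Set.disjoint_left]
      intro o ho hbad
      refine hbad ?_
      have hfst := map_fst_of_mem_support_pullAll ho
      have hlen : o.length = T - h.length := by simpa using congrArg List.length hfst
      have hr1 : regret F o ≤ o.length * (8 * (1 + q) * (1 / 2 : ℝ) ^ j) := by
        refine regret_le fun x hx => ?_
        have h1 : x.1 ∈ o.map Prod.fst := List.mem_map_of_mem hx
        rw [hfst] at h1
        obtain ⟨i, -, hi⟩ := List.mem_map.1 h1
        obtain ⟨C₀, hC₀, -⟩ := hA.exists_mem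
        obtain ⟨C, hC, hmem⟩ := sel.fill_mem h j A i (List.ne_nil_of_mem hC₀) hA.index_lt
        rw [← hi]
        exact hA.value_le C hC _ hmem
      have hr2 := hW j A hA o.length (by omega)
      have hr3 := hWtot (j + 1)
      rw [Finset.sum_range_succ] at hr3
      have hlen' : (h.length : ℝ) + o.length = T := by
        rw [hlen, Nat.cast_sub hh.le]; ring
      refine ⟨by rw [List.length_append]; omega, ?_⟩
      rw [regret_append, ← hlen', add_mul]
      linarith
    · push Not at hT
      obtain ⟨C₀, hC₀, -⟩ := hA.exists_mem
      have hApos : 0 < A.length := List.length_pos_of_mem hC₀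
      have hANpos : A.length ≤ A.length * pulls j := Nat.le_mul_of_pos_right _ (hpulls j)
      refine (pmf_toOuterMeasure_bind_le (a := A.length * β)
        (b := (T - (h.length + A.length * pulls j) : ℕ) * β)
        (G := {b | ∀ e ∈ b, Accurate F q j e}) ?_ ?_).trans ?_
      · refine toOuterMeasure_playBatch_le fun C hC => ?_
        refine (toOuterMeasure_pullAll_not_accurate_le hlip hc hr hmean hq ?_ ?_).trans ?_
        · have := (hpulls j).ne'
          simpa using this
        · intro z hz
          obtain ⟨i, -, rfl⟩ := List.mem_map.1 hz
          exact sel.pick_mem h j C i (hA.index_lt C hC)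
        · simpa using hβ j
      · intro b hb hacc
        have hrec := isRecord_of_mem_support hb
        have hlen : (h ++ b.flatMap Prod.snd).length = h.length + A.length * pulls j := by
          rw [List.length_append, hrec.length_flatMap]
        rw [← hlen]
        refine ih (j + 1) _ _ (hA.next hpos hz₀ hrec.1 hacc) (by omega) (by omega) ?_
        rw [regret_append, hlen, Finset.sum_range_succ]
        have h1 := hrec.regret_le (F := F) fun C hC i =>
          hA.value_le C hC _ (sel.pick_mem h j C i (hA.index_lt C hC))
        have h2 := hW j A hA _ le_rfl
        push_cast at h1 h2 ⊢
        linarith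
      · rw [← add_mul, ← Nat.cast_add]
        refine mul_le_mul_left ?_ _
        exact_mod_cast (by omega)

end Algorithm

/-! ### The regret sum over the coarse levels. -/

theorem sum_two_pow_le (N : ℕ) : ∑ i ∈ Finset.range N, (2 : ℝ) ^ i ≤ 2 ^ N := by
  induction N with
  | zero => simp
  | succ N ih => rw [Finset.sum_range_succ, pow_succ]; linarith

theorem sum_three_quarters_pow_le (N : ℕ) : ∑ i ∈ Finset.range N, (3 / 4 : ℝ) ^ i ≤ 4 := by
  have : ∑ i ∈ Finset.range N, (3 / 4 : ℝ) ^ i = 4 - 4 * (3 / 4) ^ N := by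
    induction N with
    | zero => simp
    | succ N ih => rw [Finset.sum_range_succ, ih, pow_succ]; ring
  rw [this]
  linarith [pow_nonneg (by norm_num : (0 : ℝ) ≤ 3 / 4) N]

/-- The regret of the batches up to level `I`, if batch `i` has at most `(B √2^i)^d` cubes. -/
theorem sum_batch_regret_le {d n T I : ℕ} (hd : 0 < d) (hn : 0 < n) (hT : 2 ≤ T)
    {A B q c x : ℝ} (hA : 4 ≤ A) (hq : 0 < q) (hc : 0 < c) (hB : B = A * (√(1 + q) / √2))
    (hqc : q ^ 3 = 4 * c ^ 2 * A ^ (d + n)) (hx0 : 0 < x) (hx1 : x ≤ 1)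
    (hxT : T * x ^ (d + n + 4) = Real.log T) (hcx : 8 * (1 + q) ^ 2 * x ^ 2 ≤ c)
    (hI : (2 : ℝ) ^ I ≤ 2 / ((1 + q) * x ^ 2)) :
    ∑ i ∈ Finset.range (I + 1), (B * √2 ^ i) ^ d *
        (2 * c ^ 2 / q ^ 2 * Real.log T * 4 ^ i + 1) * (8 * (1 + q) * (1 / 2 : ℝ) ^ i)
      ≤ 2 * ((1 + q) ^ 2 * x ^ 2) * T := by
  obtain ⟨e, rfl⟩ : ∃ e, d = e + 1 := ⟨d - 1, by omega⟩
  obtain ⟨f, rfl⟩ : ∃ f, n = f + 1 := ⟨n - 1, by omega⟩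
  have hT' : (2 : ℝ) ≤ T := by exact_mod_cast hT
  have hlog : 1 / 2 ≤ Real.log T :=
    (by linarith [Real.log_two_gt_d9] : 1 / 2 ≤ Real.log 2).trans
      (Real.log_le_log two_pos hT')
  have hs0 : 0 < √2 := Real.sqrt_pos.2 two_pos
  have hs2 : √2 ^ 2 = 2 := Real.sq_sqrt zero_le_two
  have hs1 : 1 ≤ √2 := by nlinarith
  have hs3 : √2 ≤ 3 / 2 := by nlinarith
  have hQ0 : 0 < √(1 + q) := Real.sqrt_pos.2 (by linarith)
  have hQ2 : √(1 + q) ^ 2 = 1 + q := Real.sq_sqrt (by linarith)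
  have hQ1 : √(1 + q) ≤ 1 + q := by nlinarith
  have hA0 : 0 < A := by linarith
  have hB0 : 0 < B := by rw [hB]; positivity
  have hBle : B ≤ A * (1 + q) := by
    rw [hB]
    refine mul_le_mul_of_nonneg_left ?_ hA0.le
    exact (div_le_self hQ0.le hs1).trans hQ1
  have hsI : √2 ^ I ≤ √2 / (√(1 + q) * x) := by
    refine le_of_sq_le_sq ?_ (by positivity)
    rw [div_pow, mul_pow, hs2, hQ2, ← pow_mul, mul_comm I, pow_mul, hs2]
    exact hI
  have hBI : ∀ i ∈ Finset.range (I + 1), B * √2 ^ i ≤ A / x := by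
    intro i hi
    calc B * √2 ^ i ≤ B * (√2 / (√(1 + q) * x)) :=
          mul_le_mul_of_nonneg_left ((pow_le_pow_right₀ hs1
            (by simpa [Nat.lt_succ_iff] using hi)).trans hsI) hB0.le
      _ = A / x := by rw [hB]; field_simp
  -- Here the n extra factors A in the zooming constant are spent: A^n ≥ 4.
  have hA1 : c ^ 2 * A ^ (e + 1) ≤ q ^ 3 / 16 := by
    have h1 : A ^ (e + 1) * 4 ≤ A ^ (e + 1 + (f + 1)) := by
      rw [pow_add A (e + 1)]
      refine mul_le_mul_of_nonneg_left ?_ (by positivity)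
      exact hA.trans (le_self_pow₀ (by linarith) (by omega))
    have := mul_le_mul_of_nonneg_left h1 (by positivity : 0 ≤ c ^ 2)
    linarith
  have hA2 : A ^ (e + 1) * x ^ 4 ≤ 1 / 1024 := by
    have h1 : (8 * (1 + q) ^ 2 * x ^ 2) ^ 2 ≤ c ^ 2 := pow_le_pow_left₀ (by positivity) hcx 2
    have h2 := mul_le_mul_of_nonneg_right h1 (by positivity : 0 ≤ A ^ (e + 1))
    have h3 : q ^ 3 ≤ (1 + q) ^ 4 :=
      (pow_le_pow_left₀ hq.le (by linarith) 3).trans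
        (pow_le_pow_right₀ (by linarith) (by norm_num))
    have h4 : 0 < (1 + q) ^ 4 := by positivity
    have h5 : (1 + q) ^ 4 * (64 * (A ^ (e + 1) * x ^ 4)) ≤ (1 + q) ^ 4 * (1 / 16) := by
      calc _ = (8 * (1 + q) ^ 2 * x ^ 2) ^ 2 * A ^ (e + 1) := by ring
        _ ≤ _ := by linarith
    have := le_of_mul_le_mul_left h5 h4
    linarith
  -- The main term takes the count of cubes at its maximum (A/x)^d and sums 2^i. The rounding term,
  -- the +1 from the ceiling, keeps one factor √2^i aside: (√2/2)^i ≤ (3/4)^i is summable.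
  have hterm : ∀ i ∈ Finset.range (I + 1), (B * √2 ^ i) ^ (e + 1) *
        (2 * c ^ 2 / q ^ 2 * Real.log T * 4 ^ i + 1) * (8 * (1 + q) * (1 / 2 : ℝ) ^ i)
      ≤ 16 * (1 + q) * (c ^ 2 / q ^ 2) * Real.log T * (A / x) ^ (e + 1) * 2 ^ i
        + 8 * (1 + q) * (A / x) ^ e * (A * (1 + q)) * (3 / 4) ^ i := by
    intro i hi
    have h4 : (4 : ℝ) ^ i * (1 / 2) ^ i = 2 ^ i := by rw [← mul_pow]; norm_num
    have h1 : (B * √2 ^ i) ^ (e + 1) ≤ (A / x) ^ (e + 1) :=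
      pow_le_pow_left₀ (by positivity) (hBI i hi) _
    have h2 : (B * √2 ^ i) ^ e ≤ (A / x) ^ e := pow_le_pow_left₀ (by positivity) (hBI i hi) _
    have h3 : √2 ^ i * (1 / 2) ^ i ≤ (3 / 4 : ℝ) ^ i := by
      rw [← mul_pow]
      exact pow_le_pow_left₀ (by positivity) (by linarith) _
    calc _ = 16 * (1 + q) * (c ^ 2 / q ^ 2) * Real.log T * (B * √2 ^ i) ^ (e + 1)
              * (4 ^ i * (1 / 2) ^ i)
            + 8 * (1 + q) * (B * √2 ^ i) ^ e * B * (√2 ^ i * (1 / 2) ^ i) := by ring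
      _ ≤ _ := by rw [h4]; gcongr
  refine (Finset.sum_le_sum hterm).trans ?_
  rw [Finset.sum_add_distrib, ← Finset.mul_sum, ← Finset.mul_sum]
  have hS1 : 16 * (1 + q) * (c ^ 2 / q ^ 2) * Real.log T * (A / x) ^ (e + 1)
      * ∑ i ∈ Finset.range (I + 1), (2 : ℝ) ^ i ≤ (1 + q) ^ 2 * x ^ 2 * T := by
    have h1 : ∑ i ∈ Finset.range (I + 1), (2 : ℝ) ^ i ≤ 2 * (2 / ((1 + q) * x ^ 2)) := by
      refine (sum_two_pow_le _).trans ?_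
      rw [pow_succ]
      linarith
    calc _ ≤ 16 * (1 + q) * (c ^ 2 / q ^ 2) * Real.log T * (A / x) ^ (e + 1)
          * (2 * (2 / ((1 + q) * x ^ 2))) := by gcongr
      _ = 64 * (c ^ 2 * A ^ (e + 1)) / q ^ 2 * (x ^ (f + 1) * x ^ 2 * T) := by
          rw [← hxT, div_pow, show e + 1 + (f + 1) + 4 = (e + 1) + (f + 1) + 4 from rfl, pow_add,
            pow_add]
          field_simp
          ring
      _ ≤ 64 * (q ^ 3 / 16) / q ^ 2 * (1 * x ^ 2 * T) := by
          have := pow_le_one₀ hx0.le hx1 (n := f + 1)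
          gcongr
      _ = 4 * q * (x ^ 2 * T) := by field_simp; ring
      _ ≤ (1 + q) ^ 2 * (x ^ 2 * T) := by
          refine mul_le_mul_of_nonneg_right ?_ (by positivity)
          nlinarith [sq_nonneg (1 - q)]
      _ = _ := by ring
  have hS2 : 8 * (1 + q) * (A / x) ^ e * (A * (1 + q))
      * ∑ i ∈ Finset.range (I + 1), (3 / 4 : ℝ) ^ i ≤ (1 + q) ^ 2 * x ^ 2 * T := by
    have hy : 0 < x ^ (e + 4) := by positivity
    have h1 : 32 * (A ^ (e + 1) * x ^ 4) ≤ x ^ 2 * T * x ^ (e + 4) := by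
      have h2 : x ^ (e + 1 + (f + 1) + 4) ≤ x ^ (e + 6) :=
        pow_le_pow_of_le_one hx0.le hx1 (by omega)
      have h3 := mul_le_mul_of_nonneg_left h2 (by positivity : (0 : ℝ) ≤ T)
      have h4 : x ^ 2 * T * x ^ (e + 4) = T * x ^ (e + 6) := by ring
      linarith
    calc _ ≤ 8 * (1 + q) * (A / x) ^ e * (A * (1 + q)) * 4 := by
          gcongr
          exact sum_three_quarters_pow_le _
      _ = (1 + q) ^ 2 * (32 * (A ^ (e + 1) * x ^ 4) / x ^ (e + 4)) := by
          rw [div_pow, pow_add x e 4, pow_succ A e]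
          field_simp
          ring
      _ ≤ (1 + q) ^ 2 * (x ^ 2 * T) := by
          gcongr
          rw [div_le_iff₀ hy]
          exact h1
      _ = _ := by ring
  linarith

/-! ### The high-probability regret bound. -/

section Regret
variable {d : ℕ} {F : Arm d → ℝ} {q : ℝ} {z₀ : Arm d} {reward : Arm d → PMF ℝ}

theorem toOuterMeasure_dblin_le (hpos : ∀ z, 0 ≤ F z) (hz₀ : F z₀ = 0)
    (hlip : ∀ z z', |F z - F z'| ≤ dist z z')
    {a c : ℝ} (hc : 0 < c) (hr : ∀ z, ∀ y ∈ (reward z).support, y ∈ Set.Icc a (a + c))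
    (hmean : ∀ z, expect (reward z) id = -F z) (hq : 0 < q)
    (sel : SelectionRule d) {T : ℕ} (hT : 2 ≤ T) {W : ℕ → ℝ} {Wtot κ : ℝ}
    (hW : ∀ j A, Active F q z₀ j A →
      ∀ k ≤ A.length * ⌈2 * c ^ 2 / q ^ 2 * Real.log T / ((1 / 2 : ℝ) ^ j) ^ 2⌉₊,
      (k : ℝ) * (8 * (1 + q) * (1 / 2 : ℝ) ^ j) ≤ W j + k * κ)
    (hWtot : ∀ j, ∑ i ∈ Finset.range j, W i ≤ Wtot) :
    (dblin reward sel T (2 * c ^ 2) (2 * c ^ 2 / q ^ 2)).toOuterMeasure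
      {o | ¬ (o.length = T ∧ regret F o ≤ Wtot + T * κ)} ≤ ENNReal.ofReal (2 / (T : ℝ) ^ 2) := by
  have hT' : (2 : ℝ) ≤ T := by exact_mod_cast hT
  have hlog : 0 < Real.log T := Real.log_pos (by linarith)
  have hthr : √(2 * c ^ 2 / (2 * c ^ 2 / q ^ 2)) = q := by
    rw [div_div_cancel₀ (by positivity), Real.sqrt_sq hq.le]
  rw [dblin, hthr]
  refine (toOuterMeasure_batches_le hpos hz₀ hlip hc hr hmean hq.le sel
    (β := ENNReal.ofReal (2 / (T : ℝ) ^ 4)) (W := W) (Wtot := Wtot) (κ := κ)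
    (fun j => Nat.ceil_pos.2 (by positivity)) ?_ hW hWtot (T + 1) 0 [fun _ => 0] []
    (active_zero hq.le hlip hz₀) (by simp; omega) (by simp) (by simp [regret])).trans ?_
  · intro j
    refine ENNReal.ofReal_le_ofReal ?_
    have h1 := Nat.le_ceil (2 * c ^ 2 / q ^ 2 * Real.log T / ((1 / 2 : ℝ) ^ j) ^ 2)
    set N : ℝ := (⌈2 * c ^ 2 / q ^ 2 * Real.log T / ((1 / 2 : ℝ) ^ j) ^ 2⌉₊ : ℝ)
    -- c₂ = 2c²/q² is what makes the Hoeffding exponent 4 ln T: failure 2T^{-4} per cube, and at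
    -- most T cubes.
    have h2 : -2 * N * (q * (1 / 2 : ℝ) ^ j) ^ 2 / c ^ 2 ≤ -(4 * Real.log T) := by
      have h3 : 2 * (2 * c ^ 2 / q ^ 2 * Real.log T / ((1 / 2 : ℝ) ^ j) ^ 2)
          * (q * (1 / 2 : ℝ) ^ j) ^ 2 / c ^ 2 ≤ 2 * N * (q * (1 / 2 : ℝ) ^ j) ^ 2 / c ^ 2 := by
        gcongr
      have h4 : 2 * (2 * c ^ 2 / q ^ 2 * Real.log T / ((1 / 2 : ℝ) ^ j) ^ 2)
          * (q * (1 / 2 : ℝ) ^ j) ^ 2 / c ^ 2 = 4 * Real.log T := by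
        field_simp
        ring
      have h5 : -2 * N * (q * (1 / 2 : ℝ) ^ j) ^ 2 / c ^ 2
          = -(2 * N * (q * (1 / 2 : ℝ) ^ j) ^ 2 / c ^ 2) := by ring
      rw [h5]
      linarith
    have h6 : Real.exp (-(4 * Real.log T)) = 1 / (T : ℝ) ^ 4 := by
      rw [Real.exp_neg, show (4 : ℝ) * Real.log T = ((4 : ℕ) : ℝ) * Real.log T by norm_num,
        Real.exp_nat_mul, Real.exp_log (by linarith), one_div]
    have h7 := Real.exp_le_exp.2 h2
    rw [h6] at h7
    calc _ ≤ 2 * (1 / (T : ℝ) ^ 4) := by gcongr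
      _ = _ := by ring
  · simp only [List.length_nil, Nat.sub_zero]
    rw [← ENNReal.ofReal_natCast, ← ENNReal.ofReal_mul (by positivity)]
    refine ENNReal.ofReal_le_ofReal ?_
    have : (T : ℝ) * (2 / (T : ℝ) ^ 4) = 2 / (T : ℝ) ^ 2 * (1 / T) := by field_simp
    rw [this]
    refine mul_le_of_le_one_right (by positivity) ?_
    rw [div_le_one (by linarith)]
    linarith

/-- Regret bound of D-BLiN. -/
theorem toOuterMeasure_regret_dblin_le {n : ℕ} (hn : 0 < n) (hpos : ∀ z, 0 ≤ F z)
    (hz₀ : F z₀ = 0) (hlip : ∀ z z', |F z - F z'| ≤ dist z z')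
    (hfin : (globalOptima F).Finite) {σ r : ℝ} (hσ : 0 < σ) (hr : 0 < r)
    (hgrowth : LocalQuadraticGrowth F σ r)
    (hsmall : (globalOptima F).ncard * (2 * r ^ 2 * √σ) ^ d ≤ 1)
    {a c : ℝ} (hc : 0 < c) (hrange : ∀ z, ∀ y ∈ (reward z).support, y ∈ Set.Icc a (a + c))
    (hmean : ∀ z, expect (reward z) id = -F z) (hq : 0 < q)
    (hqc : q ^ 3 = 4 * c ^ 2 * (4 / (r ^ 2 * σ)) ^ (d + n))
    (sel : SelectionRule d) {T : ℕ} (hT : 2 ≤ T) {x : ℝ} (hx0 : 0 < x) (hx1 : x ≤ 1)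
    (hxT : T * x ^ (d + n + 4) = Real.log T) :
    (dblin reward sel T (2 * c ^ 2) (2 * c ^ 2 / q ^ 2)).toOuterMeasure
      {o | ¬ (o.length = T ∧ regret F o ≤ T * (8 * (1 + q) ^ 2 * x ^ 2))}
        ≤ ENNReal.ofReal (2 / (T : ℝ) ^ 2) := by
  have hT' : (2 : ℝ) ≤ T := by exact_mod_cast hT
  have hlog : 0 < Real.log T := Real.log_pos (by linarith)
  -- If F is below the target everywhere, only the length of the run matters. Otherwise an arm z
  -- above the target forces d > 0, c ≥ 8(1 + q)²x² (two reward means differ by at most c) and (1 +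
  -- q)x² ≤ 1.
  by_cases htriv : ∀ z, F z ≤ 8 * (1 + q) ^ 2 * x ^ 2
  · refine le_trans (MeasureTheory.measure_mono ?_) (toOuterMeasure_dblin_le hpos hz₀ hlip hc
      hrange hmean hq sel hT (W := 0) (Wtot := 0) (κ := 8 * (1 + q)) ?_ (by simp))
    · rintro o ho ⟨h1, -⟩
      refine ho ⟨h1, ?_⟩
      rw [← h1]
      exact regret_le fun y _ => htriv y.1
    · intro j A _ k _
      have : (1 / 2 : ℝ) ^ j ≤ 1 := pow_le_one₀ (by norm_num) (by norm_num)
      rw [Pi.zero_apply, zero_add]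
      exact mul_le_mul_of_nonneg_left (mul_le_of_le_one_right (by positivity) this)
        (Nat.cast_nonneg k)
  · obtain ⟨z, hz⟩ := not_forall.1 htriv
    push Not at hz
    have hd : 0 < d := by
      refine Nat.pos_of_ne_zero ?_
      rintro rfl
      have : z = z₀ := Subsingleton.elim _ _
      rw [this, hz₀] at hz
      exact absurd hz (not_lt.2 (by positivity))
    have hcx : 8 * (1 + q) ^ 2 * x ^ 2 ≤ c := by
      have h1 := expect_mem_Icc (p := reward z) (f := id) (hrange z)
      have h2 := expect_mem_Icc (p := reward z₀) (f := id) (hrange z₀)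
      rw [hmean] at h1 h2
      linarith [h1.1, h1.2, h2.1, h2.2]
    have hy1 : (1 + q) * x ^ 2 ≤ 1 := by
      by_contra! h
      have h1 := (active_zero hq.le hlip hz₀).value_le (fun _ => 0) (by simp) z (fun i => by
        simpa using ⟨z.2.1 i, z.2.2 i⟩)
      have h2 := mul_lt_mul_of_pos_left h (by positivity : 0 < 8 * (1 + q))
      rw [pow_zero, mul_one] at h1
      rw [mul_one] at h2
      have h3 : 8 * (1 + q) * ((1 + q) * x ^ 2) = 8 * (1 + q) ^ 2 * x ^ 2 := by ring
      linarith
    have hσr := sigma_mul_sq_le_one hd hσ hr hlip hfin (z₀ := z₀)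
      (fun z => hz₀ ▸ hpos z) hgrowth hsmall
    have hA : 4 ≤ 4 / (r ^ 2 * σ) := by
      rw [le_div_iff₀ (by positivity)]
      linarith
    have hy0 : 0 < (1 + q) * x ^ 2 := by positivity
    -- The cut-off level I = N + 1 is the first with 2^{-I} < (1 + q)x².
    obtain ⟨N, hN1, hN2⟩ := exists_nat_pow_near_of_lt_one hy0 hy1
      (by norm_num : (0 : ℝ) < 1 / 2) (by norm_num)
    set I := N + 1 with hI
    have hI2 : (2 : ℝ) ^ I ≤ 2 / ((1 + q) * x ^ 2) := by
      rw [one_div_pow, le_div_iff₀ (by positivity)] at hN2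
      rw [hI, pow_succ, le_div_iff₀ hy0]
      linarith
    set B : ℝ := √(8 * (1 + q)) / (r ^ 2 * σ) with hB
    have hB' : B = 4 / (r ^ 2 * σ) * (√(1 + q) / √2) := by
      have h1 : √(8 * (1 + q)) = 4 * (√(1 + q) / √2) := by
        rw [show 8 * (1 + q) = 4 ^ 2 * ((1 + q) / 2) by ring, Real.sqrt_mul (by norm_num),
          Real.sqrt_sq (by norm_num), Real.sqrt_div (by linarith)]
      rw [hB, h1]
      ring
    set Y : ℕ → ℝ := fun i => (B * √2 ^ i) ^ d *
        (2 * c ^ 2 / q ^ 2 * Real.log T * 4 ^ i + 1) * (8 * (1 + q) * (1 / 2 : ℝ) ^ i) with hY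
    have hY0 : ∀ i, 0 ≤ Y i := fun i => by simp only [hY]; positivity
    have hsum := sum_batch_regret_le hd hn hT hA hq hc hB' hqc hx0 hx1 hxT hcx hI2
    -- Levels up to I have budget Y i. Beyond I every pull costs at most 8(1 + q)2^{-(I+1)} = κ. The
    -- total is at most (2 + 4)(1 + q)²x²T.
    refine le_trans (MeasureTheory.measure_mono ?_) (toOuterMeasure_dblin_le hpos hz₀ hlip hc
      hrange hmean hq sel hT (W := fun i => if i ∈ Finset.range (I + 1) then Y i else 0)
      (Wtot := ∑ i ∈ Finset.range (I + 1), Y i) (κ := 4 * (1 + q) * (1 / 2) ^ I) ?_ ?_)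
    · rintro o ho ⟨h1, h2⟩
      refine ho ⟨h1, h2.trans ?_⟩
      have h3 : 4 * (1 + q) * (1 / 2 : ℝ) ^ I ≤ 4 * (1 + q) * ((1 + q) * x ^ 2) := by gcongr
      have h4 := mul_le_mul_of_nonneg_left h3 (by positivity : (0 : ℝ) ≤ T)
      have h5 : 0 ≤ T * ((1 + q) ^ 2 * x ^ 2) := by positivity
      linarith
    · intro j A hAct k hk
      by_cases hj : j ∈ Finset.range (I + 1)
      · simp only [if_pos hj]
        have hcard := card_sublevel_cubes_le hσ hr hfin hpos hz₀ hgrowth hsmall hσr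
          (K := 8 * (1 + q)) (by positivity) (j := j) (S := A.toFinset)
          (by simpa using hAct.index_lt) (fun C hC z hz => by
            refine (hAct.value_le C (by simpa using hC) z hz).trans_eq ?_
            rw [one_div_pow]
            ring)
        rw [List.toFinset_card_of_nodup hAct.nodup] at hcard
        have hceil := (Nat.ceil_lt_add_one (a := 2 * c ^ 2 / q ^ 2 * Real.log T
          / ((1 / 2 : ℝ) ^ j) ^ 2) (by positivity)).le
        have h4 : 2 * c ^ 2 / q ^ 2 * Real.log T / ((1 / 2 : ℝ) ^ j) ^ 2
            = 2 * c ^ 2 / q ^ 2 * Real.log T * 4 ^ j := by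
          rw [← pow_mul, mul_comm j, pow_mul, one_div_pow, one_div_pow]
          norm_num
        rw [h4] at hceil hk
        have hk' : (k : ℝ) ≤ A.length * (⌈2 * c ^ 2 / q ^ 2 * Real.log T * 4 ^ j⌉₊ : ℝ) := by
          exact_mod_cast hk
        have h5 : (k : ℝ) ≤ (B * √2 ^ j) ^ d * (2 * c ^ 2 / q ^ 2 * Real.log T * 4 ^ j + 1) :=
          hk'.trans (mul_le_mul hcard hceil (by positivity) (by positivity))
        have h6 : 0 ≤ (k : ℝ) * (4 * (1 + q) * (1 / 2) ^ I) := by positivity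
        have h7 := mul_le_mul_of_nonneg_right h5
          (by positivity : 0 ≤ 8 * (1 + q) * (1 / 2 : ℝ) ^ j)
        simp only [hY]
        linarith
      · simp only [if_neg hj, zero_add]
        have hIj : I + 1 ≤ j := by simpa using hj
        have h1 : (1 / 2 : ℝ) ^ j ≤ (1 / 2) ^ (I + 1) :=
          pow_le_pow_of_le_one (by norm_num) (by norm_num) hIj
        rw [pow_succ] at h1
        refine mul_le_mul_of_nonneg_left ?_ (by positivity)
        have h2 := mul_le_mul_of_nonneg_left h1 (by positivity : 0 ≤ 8 * (1 + q))
        linarith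
    · intro j
      rw [← Finset.sum_filter]
      exact Finset.sum_le_sum_of_subset_of_nonneg
        (fun i hi => (Finset.mem_filter.1 hi).2) fun i _ _ => hY0 i

end Regret

/-! ### From average regret to the arm at a random time. -/

section Markov
variable {d : ℕ}

/-- Markov's inequality under the uniform law on the T pulls. -/
theorem ofReal_le_toOuterMeasure_uniform {T : ℕ} [NeZero T] {h : List (Arm d × ℝ)}
    (hlen : h.length = T) {e : Arm d → ℝ} (he : ∀ z, 0 ≤ e z) {B : ℝ} (hB : 0 < B)
    (hsum : (h.map fun o => e o.1).sum ≤ T * B) {w : ℝ} (hw : 0 < w) {S : Set (Option (Arm d))}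
    (hS : ∀ z, e z ≤ w * B → some z ∈ S) :
    ENNReal.ofReal (1 - w⁻¹) ≤ ((PMF.uniformOfFintype (Fin T)).map
      fun t => h[(t : ℕ)]?.map Prod.fst).toOuterMeasure S := by
  classical
  subst hlen
  have hT : 0 < (h.length : ℝ) := by exact_mod_cast Nat.pos_of_ne_zero (NeZero.ne h.length)
  set P : Finset (Fin h.length) := Finset.univ.filter fun t => e h[(t : ℕ)].1 ≤ w * B with hP
  have hsub : (P : Set (Fin h.length)) ⊆
      (fun t : Fin h.length => h[(t : ℕ)]?.map Prod.fst) ⁻¹' S := by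
    intro t ht
    have : e h[(t : ℕ)].1 ≤ w * B := by simpa [hP] using ht
    simpa using hS _ this
  rw [PMF.toOuterMeasure_map_apply]
  -- The time enters as a natural number, so its law is the push-forward of the uniform law under
  -- `Fin.val`.
  change _ ≤ ((PMF.uniformOfFintype (Fin h.length)).map Fin.val).toOuterMeasure _
  rw [PMF.toOuterMeasure_map_apply]
  refine le_trans ?_ (MeasureTheory.measure_mono (s := (P : Set (Fin h.length))) hsub)
  rw [PMF.toOuterMeasure_apply_finset]
  simp only [PMF.uniformOfFintype_apply, Fintype.card_fin, Finset.sum_const, nsmul_eq_mul]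
  rw [← ENNReal.ofReal_natCast, ← ENNReal.ofReal_natCast, ← ENNReal.ofReal_inv_of_pos hT,
    ← ENNReal.ofReal_mul (by positivity)]
  refine ENNReal.ofReal_le_ofReal ?_
  have h1 : ∑ t : Fin h.length, e h[(t : ℕ)].1 ≤ h.length * B := by
    rw [← Fin.sum_univ_fun_getElem] at hsum
    exact hsum
  have h2 : ((h.length : ℝ) - P.card) * (w * B) ≤ ∑ t : Fin h.length, e h[(t : ℕ)].1 := by
    have h3 : ((h.length : ℝ) - P.card) * (w * B)
        = ∑ t : Fin h.length, if e h[(t : ℕ)].1 ≤ w * B then 0 else w * B := by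
      rw [← Finset.sum_filter_not_add_sum_filter (p := fun t : Fin h.length => e h[(t : ℕ)].1 ≤ w * B)]
      rw [Finset.sum_congr (s₁ := Finset.univ.filter fun t : Fin h.length => e h[(t : ℕ)].1 ≤ w * B)
        rfl fun t ht => if_pos (Finset.mem_filter.1 ht).2,
        Finset.sum_congr (s₁ := Finset.univ.filter fun t : Fin h.length => ¬ e h[(t : ℕ)].1 ≤ w * B)
        rfl fun t ht => if_neg (Finset.mem_filter.1 ht).2]
      have h4 := Finset.card_filter_add_card_filter_not (s := (Finset.univ : Finset (Fin h.length)))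
        (fun t => e h[(t : ℕ)].1 ≤ w * B)
      rw [Finset.card_univ, Fintype.card_fin, ← hP] at h4
      have h5 : (P.card : ℝ) + (Finset.univ.filter fun t : Fin h.length =>
        ¬ e h[(t : ℕ)].1 ≤ w * B).card = h.length := by exact_mod_cast h4
      simp only [Finset.sum_const, nsmul_eq_mul, smul_zero, add_zero]
      rw [← h5]
      ring
    rw [h3]
    refine Finset.sum_le_sum fun t _ => ?_
    split_ifs with h4
    · exact he _
    · exact (not_le.1 h4).le
  have h6 : ((h.length : ℝ) - P.card) * w ≤ h.length := by
    refine le_of_mul_le_mul_right ?_ hB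
    linarith
  rw [← div_eq_mul_inv, le_div_iff₀ hT, sub_mul, one_mul, inv_mul_eq_div, sub_le_comm,
    le_div_iff₀ hw]
  exact h6

theorem ofReal_le_toOuterMeasure_randomPulledArm {T : ℕ} [NeZero T]
    {run : PMF (List (Arm d × ℝ))} {G : Set (List (Arm d × ℝ))} {δ : ℝ} (hδ0 : 0 ≤ δ)
    (hδ1 : δ ≤ 1) (hG : run.toOuterMeasure Gᶜ ≤ ENNReal.ofReal δ) {w : ℝ}
    {S : Set (Option (Arm d))}
    (hS : ∀ h ∈ G, ENNReal.ofReal (1 - w⁻¹) ≤ ((PMF.uniformOfFintype (Fin T)).map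
      fun t => h[(t : ℕ)]?.map Prod.fst).toOuterMeasure S) :
    ENNReal.ofReal ((1 - w⁻¹) * (1 - δ)) ≤ (randomPulledArm T run).toOuterMeasure S := by
  rcases le_total (1 - w⁻¹) 0 with h0 | h0
  · rw [ENNReal.ofReal_of_nonpos (mul_nonpos_of_nonpos_of_nonneg h0 (by linarith))]
    exact zero_le
  have hrun : ENNReal.ofReal (1 - δ) ≤ run.toOuterMeasure G := by
    rw [ENNReal.ofReal_sub _ hδ0, ENNReal.ofReal_one, tsub_le_iff_right]
    exact (pmf_one_le_add_compl run G).trans (by gcongr)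
  rw [randomPulledArm, PMF.toOuterMeasure_bind_apply, ENNReal.ofReal_mul h0, mul_comm]
  calc _ ≤ run.toOuterMeasure G * ENNReal.ofReal (1 - w⁻¹) := by gcongr
    _ = ∑' h, G.indicator run h * ENNReal.ofReal (1 - w⁻¹) := by
        rw [PMF.toOuterMeasure_apply, ENNReal.tsum_mul_right]
    _ ≤ _ := by
        refine ENNReal.tsum_le_tsum fun h => ?_
        by_cases hh : h ∈ G
        · rw [Set.indicator_of_mem hh]
          exact mul_le_mul_right (hS h hh) _
        · rw [Set.indicator_of_notMem hh, zero_mul]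
          exact zero_le

/-- Concavity of the square root, in the form (∑ √y)² ≤ T ∑ y. -/
theorem sum_add_sqrt_le {F : Arm d → ℝ} (hF : ∀ z, 0 ≤ F z) {h : List (Arm d × ℝ)} {T : ℕ}
    (hlen : h.length = T) {a L v : ℝ} (hL : 0 ≤ L) (hreg : regret F h ≤ T * v) :
    (h.map fun o => a + √(L * F o.1)).sum ≤ T * (a + √(L * v)) := by
  subst hlen
  have h1 : (h.map fun o => a + √(L * F o.1)).sum
      = h.length * a + ∑ t : Fin h.length, √(L * F h[(t : ℕ)].1) := by
    rw [← Fin.sum_univ_fun_getElem, Finset.sum_add_distrib]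
    simp
  have h2 : regret F h = ∑ t : Fin h.length, F h[(t : ℕ)].1 := by
    rw [regret, ← Fin.sum_univ_fun_getElem]
  have h3 : (∑ t : Fin h.length, √(L * F h[(t : ℕ)].1)) ^ 2
      ≤ h.length * (h.length * (L * v)) := by
    refine (sq_sum_le_card_mul_sum_sq).trans ?_
    rw [Finset.card_univ, Fintype.card_fin]
    refine mul_le_mul_of_nonneg_left ?_ (Nat.cast_nonneg _)
    rw [Finset.sum_congr rfl fun t _ => Real.sq_sqrt (mul_nonneg hL (hF _)), ← Finset.mul_sum,
      ← h2]
    have := mul_le_mul_of_nonneg_left hreg hL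
    linarith
  have h4 : ∑ t : Fin h.length, √(L * F h[(t : ℕ)].1) ≤ h.length * √(L * v) := by
    have h5 := Real.le_sqrt_of_sq_le h3
    rw [← mul_assoc, Real.sqrt_mul (by positivity), Real.sqrt_mul_self (by positivity)] at h5
    exact h5
  rw [h1, mul_add]
  linarith

end Markov

/-! ### Assembly. -/

theorem totalActions_eq {n : ℕ} {m : Fin n → ℕ} (h : ∀ k, 0 < m k) :
    totalActions m = cubeDim m + n := by
  have h1 : ∀ k, m k = (m k - 1) + 1 := fun k => by have := h k; omega
  rw [totalActions, Finset.sum_congr rfl fun k _ => h1 k, Finset.sum_add_distrib, cubeDim]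
  simp

end NashBandit

theorem mainTheorem1 {n : ℕ} (hn : 0 < n) (m : Fin n → ℕ)
    (u : Fin n → Profile m → ℝ) (hu : ∀ k a, u k a ∈ Set.Icc (0 : ℝ) 1)
    (est : GradientEstimator u)
    (p : ℝ) (hp : p ∈ Set.Ioo (0 : ℝ) 1)
    (τ : ℝ) (hτ : τ = 1 / Real.log (1 / p))
    (η : Fin n → ℝ) (hη : ∀ k, η k = 2 / Lhat m p)
    (s : Arm (cubeDim m) → MixedProfile m)
    (hs_interior : ∀ z k l, p / maxActions m ≤ (s z k).1 l)
    (hs_qre : ∃ z, IsQRE u τ (s z))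
    (F : Arm (cubeDim m) → ℝ) (hF : ∀ z, F z = loss u η τ (s z))
    (hF_lip : ∀ z z', |F z - F z'| ≤ dist z z')
    (hfin : (globalOptima F).Finite)
    (σ r : ℝ) (hσ : 0 < σ) (hr : 0 < r)
    (hgrowth : LocalQuadraticGrowth F σ r)
    (hsmall : 1 ≤ ((globalOptima F).ncard : ℝ)⁻¹ * ((2 * r ^ 2 * √σ) ^ cubeDim m)⁻¹)
    (reward : Arm (cubeDim m) → PMF ℝ)
    (hreward : ∀ z, reward z = (lossSample est η τ (s z)).map fun y => -y) :
    (∀ x y : MixedProfile m, (∀ k l, p / maxActions m ≤ (x k).1 l) →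
      (∀ k l, p / maxActions m ≤ (y k).1 l) →
      |loss u η τ x - loss u η τ y| ≤ ∑ k, ∑ l, |(x k).1 l - (y k).1 l|) ∧
    RangeLE reward (rangeBound m p) ∧
    ∀ c : ℝ, 0 < c → RangeLE reward c → c ≤ rangeBound m p →
      ∀ (sel : SelectionRule (cubeDim m)) (T : ℕ) [NeZero T], 2 ≤ T →
        ∀ w : ℝ, 0 < w →
          ENNReal.ofReal ((1 - w⁻¹) * (1 - 2 / (T : ℝ) ^ 2)) ≤
            (randomPulledArm T (dblin reward sel T (2 * c ^ 2)
                (2 * (c / (4 * zoomConst m σ r)) ^ (2 / 3 : ℝ)))).toOuterMeasure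
              {o | ∃ z, o = some z ∧ exploitability u (s z) ≤ w * pacBound m p c σ r T} := by
  have hint : ∀ z, IsInterior p (s z) := hs_interior
  obtain ⟨z₀, hqre⟩ := hs_qre
  have hτ0 : 0 < τ := by rw [hτ]; exact one_div_pos.2 (log_inv_pos hp)
  refine ⟨fun x y hx hy => abs_loss_sub_le hn hu hp hτ hη hx hy, ?_, ?_⟩
  · refine ⟨-(rangeBound m p / 2), fun z y hy => ?_⟩
    rw [hreward, PMF.mem_support_map_iff] at hy
    obtain ⟨y', hy', rfl⟩ := hy
    obtain ⟨g, g', hg, hg', rfl⟩ := mem_support_lossSample hy'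
    have := abs_le.1 (abs_sampleValue_le hp hn (hint z) hτ hη hg hg')
    constructor <;> linarith [this.1, this.2]
  intro c hc hrange _ sel T _ hT w hw
  obtain ⟨a, hrange⟩ := hrange
  have hL : 0 < Lhat m p := Lhat_pos hp (s z₀) hn
  have hη0 : ∀ k, 0 ≤ η k := fun k => by rw [hη]; positivity
  have hpos : ∀ z, 0 ≤ F z := fun z => by rw [hF]; exact loss_nonneg hη0 τ _
  have hz₀ : F z₀ = 0 := by rw [hF]; exact loss_eq_zero_of_isQRE hτ0.ne' hqre
  have hmean : ∀ z, expect (reward z) id = -F z := fun z => by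
    rw [hreward, hF]
    exact expect_neg_lossSample hn est hp hτ hη (hint z)
  have hM := totalActions_eq (action_pos (s z₀))
  have hT' : (2 : ℝ) ≤ T := by exact_mod_cast hT
  have hlog : 0 < Real.log T := Real.log_pos (by linarith)
  have hlogT : Real.log T / T ≤ 1 := by
    rw [div_le_one (by linarith)]
    exact Real.log_le_self (by linarith)
  have hlogT0 : 0 < Real.log T / T := div_pos hlog (by linarith)
  have hsmall' : (globalOptima F).ncard * (2 * r ^ 2 * √σ) ^ cubeDim m ≤ 1 := by
    rw [← mul_inv] at hsmall
    have h0 : 0 < ((globalOptima F).ncard : ℝ) * (2 * r ^ 2 * √σ) ^ cubeDim m := by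
      have := Real.sqrt_pos.2 hσ
      have h1 : 0 < ((globalOptima F).ncard : ℝ) := by
        exact_mod_cast (Set.ncard_pos hfin).2 ⟨z₀, fun z => hz₀ ▸ hpos z⟩
      positivity
    exact (one_le_inv₀ h0).1 hsmall
  have hCz : 0 < zoomConst m σ r := by unfold zoomConst; positivity
  have hD : 0 < 4 * c ^ 2 * zoomConst m σ r := by positivity
  -- This is √(c₁/c₂) for the prescribed parameters, as c₂ = 2c²/q² shows.
  set q : ℝ := (4 * c ^ 2 * zoomConst m σ r) ^ (1 / 3 : ℝ) with hq
  have hq0 : 0 < q := Real.rpow_pos_of_pos hD _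
  have hq3 : q ^ 3 = 4 * c ^ 2 * zoomConst m σ r := by
    rw [hq, ← Real.rpow_natCast, ← Real.rpow_mul hD.le]
    norm_num
  have hc2 : 2 * (c / (4 * zoomConst m σ r)) ^ (2 / 3 : ℝ) = 2 * c ^ 2 / q ^ 2 := by
    rw [mul_div_assoc]
    congr 1
    rw [eq_div_iff (by positivity), hq, ← Real.rpow_natCast (_ ^ (1 / 3 : ℝ)) 2,
      ← Real.rpow_mul hD.le, show (1 / 3 : ℝ) * ((2 : ℕ) : ℝ) = 2 / 3 by norm_num,
      ← Real.mul_rpow (by positivity) hD.le,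
      show c / (4 * zoomConst m σ r) * (4 * c ^ 2 * zoomConst m σ r) = c ^ (3 : ℝ) by
        rw [show (3 : ℝ) = ((3 : ℕ) : ℝ) by norm_num, Real.rpow_natCast]
        field_simp,
      ← Real.rpow_mul hc.le, ← Real.rpow_natCast]
    norm_num
  -- Since 2(d_z + 2) = d + n + 4, x solves T x^{d+n+4} = ln T.
  set x : ℝ := (Real.log T / T) ^ (1 / (2 * (zoomDim m + 2))) with hx
  have hx0 : 0 < x := Real.rpow_pos_of_pos hlogT0 _
  have hx1 : x ≤ 1 := Real.rpow_le_one hlogT0.le hlogT (by unfold zoomDim; positivity)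
  have hxT : T * x ^ (cubeDim m + n + 4) = Real.log T := by
    have : x ^ (cubeDim m + n + 4) = Real.log T / T := by
      rw [hx, ← Real.rpow_natCast, ← Real.rpow_mul hlogT0.le]
      have h1 : 1 / (2 * (zoomDim m + 2)) * ((cubeDim m + n + 4 : ℕ) : ℝ) = 1 := by
        rw [zoomDim, hM]
        push_cast
        field_simp
        ring
      rw [h1, Real.rpow_one]
    rw [this]
    field_simp
  have hreg := toOuterMeasure_regret_dblin_le hn hpos hz₀ hF_lip hfin hσ hr hgrowth hsmall' hc
    hrange hmean hq0 (by rw [hq3, zoomConst, hM]) sel hT hx0 hx1 hxT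
  rw [hc2]
  set Λ : ℝ := τ * Real.log ((∏ k, m k : ℕ) : ℝ) with hΛ
  have hΛ0 : 0 ≤ Λ := mul_nonneg hτ0.le (Real.log_natCast_nonneg _)
  have hB : pacBound m p c σ r T = Λ + 2 * (1 + q) * √(2 * n * Lhat m p) * x := by
    rw [pacBound, hΛ, hτ]
  have hn' : (1 : ℝ) ≤ n := by exact_mod_cast hn
  have hB0 : 0 < pacBound m p c σ r T := by
    rw [hB]
    have : 0 < √(2 * n * Lhat m p) := Real.sqrt_pos.2 (by positivity)
    positivity
  -- The left side is 2(1 + q)√(2L̂) x; the factor n ≥ 1 only weakens the bound.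
  have hroot : √(Lhat m p * (8 * (1 + q) ^ 2 * x ^ 2))
      ≤ 2 * (1 + q) * √(2 * n * Lhat m p) * x := by
    rw [Real.sqrt_le_left (by positivity), mul_pow, mul_pow, Real.sq_sqrt (by positivity)]
    have h1 : 0 ≤ Lhat m p * (8 * (1 + q) ^ 2 * x ^ 2) := by positivity
    have h2 := mul_le_mul_of_nonneg_left hn' h1
    linarith
  have hδ1 : 2 / (T : ℝ) ^ 2 ≤ 1 := by
    rw [div_le_one (by positivity)]
    nlinarith
  refine ofReal_le_toOuterMeasure_randomPulledArm (by positivity) hδ1 hreg fun h hh => ?_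
  obtain ⟨hlen, hsum⟩ := hh
  refine ofReal_le_toOuterMeasure_uniform hlen (e := fun z => Λ + √(Lhat m p * F z))
    (fun z => by positivity) hB0 ?_ hw fun z hz => ⟨z, rfl, ?_⟩
  · refine (sum_add_sqrt_le hpos hlen hL.le hsum).trans ?_
    rw [hB]
    gcongr
  · refine le_trans ?_ hz
    have := exploitability_le hn u hp hτ0.le hη (hint z)
    rwa [← hF] at this
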